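/- **Setting.** Consider the plant $x_{t+1}=Fx_t+Gu_t+w_t$, $y_t=Hx_t+v_t$ with state $x_t\in\mathbb R^{m_x}$, inputs $u_t\in\mathbb R^{m_u}$ and scalar measurements $y_t\in\mathbb R$, where $(F,H)$ is observable, $(F,G)$ is controllable, the spectral radius satisfies $\rho(F)>1$, the noises are bounded, $\|w_t\|_\infty<W/2$ and $|v_t|<V/2$ with $W,V>0$, and $x_0$ lies in a known ellipsoid $\mathcal E(P_0,0)$, $P_0\succ0$, where $\mathcal E(P,c)=\{x:(x-c)^{T}P^{-1}(x-c)\le 1\}$. Let $z^{m_x}+a_1z^{m_x-1}+\dots+a_{m_x}$ be the characteristic polynomial of $F$. At each time $t$ the observer produces a message $b_t\in\{0,1\}^k$ from $y_0,\dots,y_t$ only (it knows neither the inputs nor the channel outputs). A causal encoder maps $b_0,\dots,b_t$ to $n\ge1$ binary inputs of a causal noisy channel without feedback, whose noise is independent of $(x_0,w,v)$; the decoder forms estimates $\hat b_{\tau|t}$, $\tau\le t$, from the channel outputs up to time $t$, and $u_{t+1}$ is computed from what has been decoded up to time $t$ ($u_0=0$). The rate is $R=k/n$. The encoder-decoder pair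 is $(R,\beta)$-anytime reliable over the channel if there are $d_0>0$ and $\eta$ such that, whatever messages are sent, $P\bigl(\min\{\tau:\hat b_{\tau|t}\ne b_\tau\}=t-d+1\bigr)\le\eta\,2^{-n\beta d}$ for all $t$ and all $d\ge d_0$. **Ellipsoidal filter.** Starting from $\mathcal E(P_0,0)$, the controller reads each decoded message as an interval of values of $y_t$, hence as a slab for $Hx_t$ (the interval enlarged by $V/2$ on both sides), replaces the predicted ellipsoid $\mathcal E(P_t,c_t)$ by the minimum volume ellipsoid $\mathcal E(P_{t|t},c_{t|t})$ covering its intersection with the slab (given by its standard closed formula), and then predicts $P_{t+1}=(1+\varepsilon)FP_{t|t}F^{T}+(1+\tfrac1\varepsilon)\,m_x\tfrac{W^2}{4}I$, $c_{t+1}=Fc_{t|t}+Gu_t$, for a fixed $\varepsilon>0$. At each time $t$ the filter is run on $\hat b_{0|t},\dots,\hat b_{t|t}$; the resulting centre is the estimate $\hat x_{t+1|t}$. **Theorem.** Suppose that $$R>\frac1n\log_2\Bigl[\sqrt{m_x}\sum_{i=1}^{m_x}|a_i|\,\theta^{\,i-1}\Bigr],\qquad \theta=\sqrt{\frac{m_x}{m_x-1}}$$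 (for $m_x=1$ the bracket is $|a_1|$). Then there are an observer, a rule assigning to each message and predicted ellipsoid an interval of measurements, a parameter $\varepsilon>0$, and a control law acting on the past and present estimates of the ellipsoidal filter and the past inputs, such that for every channel, every $\beta$ with $$n\beta>2\log_2\rho(F),$$ and every encoder-decoder pair that is $(R,\beta)$-anytime reliable over that channel: the filter's ellipsoid at time $t$ contains $x_{t+1}$ whenever $\hat b_{\tau|t}=b_\tau$ for all $\tau\le t$; the filter tracks the plant, $\limsup_{t}\mathbb E\|x_{t+1}-\hat x_{t+1|t}\|^2<\infty$; and the plant is stabilized in the mean squared sense, $\limsup_t\mathbb E\|x_t\|^2<\infty$. -/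

import Mathlib

open Matrix MeasureTheory Filter

namespace AnytimeControl

/-! ### The plant -/

/-- Data of the plant `x_{t+1} = F x_t + G u_t + w_t`, `y_t = ⟨h, x_t⟩ + v_t` with scalar
measurements (`H = hᵀ`), state dimension `m` and input dimension `mu`.  The noises satisfy
`‖w_t‖_∞ < W / 2` and `|v_t| < V / 2`; the initial state lies in the ellipsoid of shape `P₀`
centred at the origin. -/
structure Plant (m mu : ℕ) where
  F : Matrix (Fin m) (Fin m) ℝ
  G : Matrix (Fin m) (Fin mu) ℝ
  h : Fin m → ℝ
  W : ℝ
  V : ℝ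
  P₀ : Matrix (Fin m) (Fin m) ℝ

/-- Kalman rank condition for `[G, F G, …, F^{m-1} G]`. -/
def Controllable {m mu : ℕ} (F : Matrix (Fin m) (Fin m) ℝ) (G : Matrix (Fin m) (Fin mu) ℝ) :
    Prop :=
  (Matrix.of fun (i : Fin m) (p : Fin m × Fin mu) => (F ^ (p.1 : ℕ) * G) i p.2).rank = m

/-- Kalman rank condition for the matrix with rows `hᵀ, hᵀ F, …, hᵀ F^{m-1}`. -/
def Observable {m : ℕ} (F : Matrix (Fin m) (Fin m) ℝ) (h : Fin m → ℝ) : Prop :=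
  (Matrix.of fun (j : Fin m) (i : Fin m) => (h ᵥ* F ^ (j : ℕ)) i).rank = m

/-- Spectral radius of a real matrix: the largest modulus of its complex eigenvalues. -/
noncomputable def specRad {m : ℕ} (F : Matrix (Fin m) (Fin m) ℝ) : ℝ :=
  (spectralRadius ℂ (F.map Complex.ofReal)).toReal

/-- The coefficient `a_i` in the characteristic polynomial
`z^m + a_1 z^{m-1} + … + a_m` of `F` (used for `1 ≤ i ≤ m`). -/
noncomputable def charCoeff {m : ℕ} (F : Matrix (Fin m) (Fin m) ℝ) (i : ℕ) : ℝ :=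
  F.charpoly.coeff (m - i)

/-! ### The ellipsoidal filter -/

/-- An ellipsoid `𝓔(P, c)` given by its shape matrix and its centre. -/
structure Ellipsoid (m : ℕ) where
  shape : Matrix (Fin m) (Fin m) ℝ
  center : Fin m → ℝ

/-- The points of `𝓔(P, c)`, for positive definite `P`. -/
def Ellipsoid.carrier {m : ℕ} (E : Ellipsoid m) : Set (Fin m → ℝ) :=
  {x | (x - E.center) ⬝ᵥ (E.shape⁻¹ *ᵥ (x - E.center)) ≤ 1}

/-- Parameters `(ξ, a, b)` of the minimum volume ellipsoid covering
`{x ∈ 𝓔(P, 0) | γ √(hᵀPh) ≤ ⟨h, x⟩ ≤ δ √(hᵀPh)}`, where `-1 ≤ γ ≤ δ ≤ 1` and `|γ| ≤ |δ|`. -/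
noncomputable def slabParamsAux (m : ℕ) (γ δ : ℝ) : ℝ × ℝ × ℝ :=
  if γ * δ ≤ -(1 / (m : ℝ)) then (0, 1, 1)
  else if γ + δ = 0 then (0, m * δ ^ 2, m * (1 - δ ^ 2) / (m - 1))
  else
    let D : ℝ := (m : ℝ) ^ 2 * (δ ^ 2 - γ ^ 2) ^ 2 + 4 * (1 - γ ^ 2) * (1 - δ ^ 2)
    let ξ : ℝ := (m * (γ + δ) ^ 2 + 2 * (1 + γ * δ) - √D) / (2 * (m + 1) * (γ + δ))
    let a : ℝ := m * (ξ - γ) * (δ - ξ)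
    (ξ, a, (a - a * γ ^ 2) / (a - (ξ - γ) ^ 2))

/-- The same parameters without the restriction `|γ| ≤ |δ|` (reflect `x ↦ -x` if it fails). -/
noncomputable def slabParams (m : ℕ) (γ δ : ℝ) : ℝ × ℝ × ℝ :=
  if |γ| ≤ |δ| then slabParamsAux m γ δ
  else
    let p := slabParamsAux m (-δ) (-γ)
    (-p.1, p.2.1, p.2.2)

/-- Truncation of a real number to `[-1, 1]`. -/
noncomputable def clip (r : ℝ) : ℝ := max (-1) (min 1 r)

/-- Measurement update: the minimum volume ellipsoid covering
`E ∩ {x | lo ≤ ⟨h, x⟩ ≤ hi}`, namely `𝓔(P', c')` with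
`P' = b P - (b - a) P h hᵀ P / (hᵀ P h)` and `c' = c + ξ P h / √(hᵀ P h)`. -/
noncomputable def Ellipsoid.measUpdate {m : ℕ} (h : Fin m → ℝ) (lo hi : ℝ) (E : Ellipsoid m) :
    Ellipsoid m :=
  let q : ℝ := h ⬝ᵥ (E.shape *ᵥ h)
  let p := slabParams m (clip ((lo - h ⬝ᵥ E.center) / √q)) (clip ((hi - h ⬝ᵥ E.center) / √q))
  { shape := p.2.2 • E.shape -
      ((p.2.2 - p.2.1) / q) • vecMulVec (E.shape *ᵥ h) (h ᵥ* E.shape)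
    center := E.center + (p.1 / √q) • (E.shape *ᵥ h) }

/-- Time update: an ellipsoid covering all `F x + G u + w` with `x ∈ E` and `‖w‖_∞ ≤ W / 2`.
The cube of the process noise lies in the ball of squared radius `m (W / 2)²`, and
`𝓔((1 + ε) A + (1 + 1 / ε) B, c)` covers `𝓔(A, c) + 𝓔(B, 0)`. -/
noncomputable def Ellipsoid.timeUpdate {m mu : ℕ} (S : Plant m mu) (ε : ℝ) (u : Fin mu → ℝ)
    (E : Ellipsoid m) : Ellipsoid m where
  shape := (1 + ε) • (S.F * E.shape * S.Fᵀ) +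
    ((1 + 1 / ε) * (m * (S.W / 2) ^ 2)) • (1 : Matrix (Fin m) (Fin m) ℝ)
  center := S.F *ᵥ E.center + S.G *ᵥ u

/-- Binary words of length `k`. -/
abbrev Word (k : ℕ) := Fin k → Bool

/-- What observer and controller may choose.
* `obs`: the observer's message `b_t`, a (measurable) function of `y_0, …, y_t` only;
* `cell`: the interval of values of `y_t` that the controller reads off from the message `b_t`,
  given the ellipsoid in which it predicts `x_t` to lie;
* `ε`: the parameter of the time update of the ellipsoidal filter;
* `law`: the input `u_{t+1}`, a function of the filter's estimates made up to time `t`,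
  i.e. of `x̂_{1|0}, …, x̂_{t+1|t}`, and of the past inputs `u_0, …, u_t`. -/
structure Strategy (m mu k : ℕ) where
  obs : ∀ t : ℕ, (Fin (t + 1) → ℝ) → Word k
  measurable_obs : ∀ t, Measurable (obs t)
  cell : Ellipsoid m → Word k → ℝ × ℝ
  ε : ℝ
  ε_pos : 0 < ε
  law : ∀ t : ℕ, (Fin (t + 1) → Fin m → ℝ) → (Fin (t + 1) → Fin mu → ℝ) → Fin mu → ℝ

/-- The predicted ellipsoid for `x_s` that the ellipsoidal filter computes from the messages
`b_0, …, b_{s-1}` and the applied inputs `u_0, …, u_{s-1}`.  Since `|v_t| < V / 2`, the knowledge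
`y_t ∈ [lo, hi]` confines the state to the slab `lo - V / 2 ≤ ⟨h, x_t⟩ ≤ hi + V / 2`. -/
noncomputable def Strategy.predict {m mu k : ℕ} (σ : Strategy m mu k) (S : Plant m mu)
    (b : ℕ → Word k) (u : ℕ → Fin mu → ℝ) : ℕ → Ellipsoid m
  | 0 => ⟨S.P₀, 0⟩
  | s + 1 =>
    let E := σ.predict S b u s
    let I := σ.cell E (b s)
    (E.measUpdate S.h (I.1 - S.V / 2) (I.2 + S.V / 2)).timeUpdate S σ.ε (u s)

/-! ### Channels, causal codes, anytime reliability -/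

/-- A causal channel without feedback, used `n` times per time step, with binary inputs and output
alphabet `Z`: the outputs at time `t` depend on the inputs up to time `t` and on the realization
of the channel noise, an element of `Ξ`. -/
structure Channel (n : ℕ) (Z Ξ : Type*) [MeasurableSpace Z] [MeasurableSpace Ξ] where
  out : ∀ t : ℕ, (Fin (t + 1) → Word n) → Ξ → Fin n → Z
  measurable_out : ∀ t c, Measurable (out t c)

/-- A causal encoder-decoder pair of rate `k / n`; `dec t z τ` is the estimate at time `t` of the
message `b_τ` (only the values for `τ ≤ t` are ever used). -/
structure Code (n k : ℕ) (Z : Type*) [MeasurableSpace Z] where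
  enc : ∀ t : ℕ, (Fin (t + 1) → Word k) → Word n
  dec : ∀ t : ℕ, (Fin (t + 1) → Fin n → Z) → ℕ → Word k
  measurable_dec : ∀ t, Measurable (dec t)

section

variable {n k : ℕ} {Z Ξ : Type*} [MeasurableSpace Z] [MeasurableSpace Ξ]

/-- The channel outputs at time `t` when the messages `b` are sent. -/
def Code.received (code : Code n k Z) (ch : Channel n Z Ξ) (b : ℕ → Word k) (ξ : Ξ) (t : ℕ) :
    Fin n → Z :=
  ch.out t (fun s : Fin (t + 1) => code.enc s (fun r : Fin ((s : ℕ) + 1) => b r)) ξ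

/-- The estimates `τ ↦ b̂_{τ|t}` made at time `t` when the messages `b` are sent. -/
def Code.decoded (code : Code n k Z) (ch : Channel n Z Ξ) (b : ℕ → Word k) (ξ : Ξ) (t : ℕ) :
    ℕ → Word k :=
  code.dec t (fun s : Fin (t + 1) => code.received ch b ξ s)

/-- The event `min {τ | b̂_{τ|t} ≠ b_τ} = t - d + 1`. -/
def Code.firstError (code : Code n k Z) (ch : Channel n Z Ξ) (b : ℕ → Word k) (t d : ℕ) : Set Ξ :=
  {ξ | ∃ τ ≤ t, τ + d = t + 1 ∧ code.decoded ch b ξ t τ ≠ b τ ∧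
    ∀ s < τ, code.decoded ch b ξ t s = b s}

/-- `(R, β)`-anytime reliability (with `R = k / n`) over a channel whose noise has law `ν`:
for some `d₀ > 0` and `η`, whatever messages are sent, the probability that the earliest error
at time `t` is `d` steps in the past is at most `η 2^{-nβd}`, for all `t` and all `d ≥ d₀`. -/
def Code.AnytimeReliable (code : Code n k Z) (ch : Channel n Z Ξ) (ν : Measure Ξ) (β : ℝ) :
    Prop :=
  ∃ d₀ : ℕ, 0 < d₀ ∧ ∃ η : ℝ, ∀ (b : ℕ → Word k) (t d : ℕ), d₀ ≤ d →
    ν (code.firstError ch b t d) ≤ ENNReal.ofReal (η * (2 : ℝ) ^ (-((n : ℝ) * β * d)))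

/-! ### The closed loop -/

/-- The filter's predicted ellipsoid for `x_{t+1}` given everything decoded at time `t`; its
centre is the estimate `x̂_{t+1|t}`. -/
noncomputable def Strategy.estimate {m mu : ℕ} (σ : Strategy m mu k) (S : Plant m mu)
    (code : Code n k Z) (ch : Channel n Z Ξ) (b : ℕ → Word k) (u : ℕ → Fin mu → ℝ) (ξ : Ξ)
    (t : ℕ) : Ellipsoid m :=
  σ.predict S (code.decoded ch b ξ t) u (t + 1)

/-- The equations of the closed loop for given initial state, noises and channel noise.  They
determine `x, u, y, b` recursively. -/
structure IsClosedLoop {m mu : ℕ} (S : Plant m mu) (σ : Strategy m mu k)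
    (code : Code n k Z) (ch : Channel n Z Ξ)
    (x₀ : Fin m → ℝ) (w : ℕ → Fin m → ℝ) (v : ℕ → ℝ) (ξ : Ξ)
    (x : ℕ → Fin m → ℝ) (u : ℕ → Fin mu → ℝ) (y : ℕ → ℝ) (b : ℕ → Word k) : Prop where
  x_zero : x 0 = x₀
  x_succ : ∀ t, x (t + 1) = S.F *ᵥ x t + S.G *ᵥ u t + w t
  y_eq : ∀ t, y t = S.h ⬝ᵥ x t + v t
  b_eq : ∀ t, b t = σ.obs t (fun s : Fin (t + 1) => y s)
  u_zero : u 0 = 0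
  u_succ : ∀ t, u (t + 1) =
    σ.law t (fun s : Fin (t + 1) => (σ.estimate S code ch b u ξ s).center)
      (fun s : Fin (t + 1) => u s)

end

/-- `limsup_t 𝔼 |X_t|² < ∞` (Euclidean norm). -/
def MeanSquareBounded {Ω : Type*} [MeasurableSpace Ω] {m : ℕ} (μ : Measure Ω)
    (X : ℕ → Ω → Fin m → ℝ) : Prop :=
  limsup (fun t => ∫⁻ ω, ENNReal.ofReal (X t ω ⬝ᵥ X t ω) ∂μ) atTop < ⊤

end AnytimeControl

namespace AnytimeControl

/-! ### The parameters of the measurement update -/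

/-! The inputs are unknown to the observer, so their effect is hidden from it: the quantizer works
modulo its range `L`, and the controller perturbs its inputs by at most `L` in a fixed direction so
that the part of every output due to inputs is a multiple of `L` (`IsClosedLoop.output_reach`). The
messages then depend on the initial state and the plant noises only (`message_eq_free`). They are
thus independent of the channel noise, and the observer's input-free copy of the filter is a
translate of the controller's filter run on correct messages (`predict_message`).

For the quantizer to be unambiguous, the predicted ellipsoid must have half width at most `L / 2 - V
/ 2` along `h`. Widths are followed along the vectors `outVec i` of the observer canonical form,
where `outVec i * F = outVec (i + 1) - a_{i+1} h` and `outVec m = 0`. A measurement makes the width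
along `h` at most `√m` times that of the slab and enlarges any other width by at most `θ`. So bounds
`M i` persist if, up to noise and a factor `√(1 + ε)`, they satisfy `|a_{i+1}| √m (L / 2^k + V) / 2
+ θ M (i + 1) ≤ M i`. Unrolled, this makes `M 0` about `L / 2` times `√m ∑ |a_i| θ^(i-1) / 2^k`, a
factor below one by the rate condition; a large `L` then leaves room for the noises
(`exists_invariant_widths`).

All cells have the same length, so these shape bounds hold for wrong messages too. The filter's
error therefore obeys `e ↦ F e` plus a bounded term and is at most `C ρ^d` when the first wrong
message is `d` steps old, for any `ρ` above the spectral radius. With `ρ^2 < 2^(nβ)`, anytime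
reliability makes the second moments a convergent geometric series (`exists_dominating`). Deadbeat
control in blocks of `m` steps bounds the state by the estimation errors at the last two block
starts (`exists_state_bound`). -/

/-- The largest factor by which a measurement update can enlarge the squared width of an
ellipsoid in some direction. -/
noncomputable def gain (m : ℕ) : ℝ := if m = 1 then 1 else (m : ℝ) / (m - 1)

theorem one_le_gain {m : ℕ} (hm : 1 ≤ m) : 1 ≤ gain m := by
  unfold gain
  split_ifs with h
  · exact le_rfl
  · have h2 : 2 ≤ m := by omega
    have : (2 : ℝ) ≤ m := by exact_mod_cast h2
    rw [le_div_iff₀ (by linarith)]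
    linarith

/-- Bounds on the parameters of a measurement update. -/
structure SlabBounds (m : ℕ) (γ δ ξ a b : ℝ) : Prop where
  abs_le : |ξ| ≤ 1
  a_nonneg : 0 ≤ a
  a_le : a ≤ m * ((δ - γ) / 2) ^ 2
  a_le_gain : a ≤ gain m
  b_nonneg : 0 ≤ b
  b_le_gain : b ≤ gain m

/-- The parameters `(ξ, a, b)` describe an ellipsoid covering the part of the unit ball between
`γ` and `δ`. -/
structure SlabCover (m : ℕ) (γ δ ξ a b : ℝ) : Prop extends SlabBounds m γ δ ξ a b where
  a_pos : 0 < a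
  b_pos : 2 ≤ m → 0 < b
  -- For `m = 1` there is no transversal direction and the closed formula for `b` divides by zero,
  -- so only `a` is constrained.
  cover_one : m = 1 → ∀ r, γ ≤ r → r ≤ δ → (r - ξ) ^ 2 ≤ a
  -- This is `(r - ξ)²/a + (1 - r²)/b ≤ 1` cleared of denominators, where `1 - r²` is the largest
  -- squared transversal distance in the unit ball.
  cover : 2 ≤ m → ∀ r, γ ≤ r → r ≤ δ → (r - ξ) ^ 2 * b + (1 - r ^ 2) * a ≤ a * b

theorem SlabBounds.reflect {m : ℕ} {γ δ ξ a b : ℝ} (h : SlabBounds m (-δ) (-γ) ξ a b) :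
    SlabBounds m γ δ (-ξ) a b where
  abs_le := by rw [abs_neg]; exact h.abs_le
  a_nonneg := h.a_nonneg
  a_le := by have := h.a_le; rwa [show -γ - -δ = δ - γ by ring] at this
  a_le_gain := h.a_le_gain
  b_nonneg := h.b_nonneg
  b_le_gain := h.b_le_gain

theorem SlabCover.reflect {m : ℕ} {γ δ ξ a b : ℝ} (h : SlabCover m (-δ) (-γ) ξ a b) :
    SlabCover m γ δ (-ξ) a b where
  toSlabBounds := h.toSlabBounds.reflect
  a_pos := h.a_pos
  b_pos := h.b_pos
  cover_one hm r h1 h2 := by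
    have := h.cover_one hm (-r) (by linarith) (by linarith)
    nlinarith
  cover hm r h1 h2 := by
    have := h.cover hm (-r) (by linarith) (by linarith)
    nlinarith

/-- The unit ball is kept. The bound on `a` in terms of the slab survives because `((δ - γ) / 2)² ≥
-γδ ≥ 1 / m`. -/
theorem slabCover_unit {m : ℕ} (hm : 1 ≤ m) {γ δ : ℝ} (hγ : -1 ≤ γ) (hδ : δ ≤ 1)
    (hcase : γ * δ ≤ -(1 / (m : ℝ))) : SlabCover m γ δ 0 1 1 := by
  have hm' : (0 : ℝ) < m := by exact_mod_cast hm
  have key : ∀ r, γ ≤ r → r ≤ δ → r ^ 2 ≤ 1 := fun r h1 h2 => by nlinarith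
  refine ⟨⟨by simp, by norm_num, ?_, one_le_gain hm, by norm_num, one_le_gain hm⟩, by norm_num,
    fun _ => by norm_num, fun _ r h1 h2 => ?_, fun _ r h1 h2 => ?_⟩
  · have h1 : 1 ≤ m * (-(γ * δ)) := by
      have := mul_le_mul_of_nonneg_left hcase hm'.le
      have h3 : (m : ℝ) * -(1 / m) = -1 := by field_simp
      linarith
    have h2 : -(γ * δ) ≤ ((δ - γ) / 2) ^ 2 := by nlinarith [sq_nonneg (γ + δ)]
    nlinarith
  · have := key r h1 h2; nlinarith
  · nlinarith

/-- Equality holds at `r² = δ²`, and elsewhere the defect is `(r² - δ²)(b - a)`, which is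
nonpositive since `a ≤ b`. -/
theorem slabCover_symm {m : ℕ} (hm : 1 ≤ m) {δ : ℝ} (hδ0 : 0 < δ)
    (hcase : -(1 / (m : ℝ)) < -δ * δ) :
    SlabCover m (-δ) δ 0 (m * δ ^ 2) (m * (1 - δ ^ 2) / (m - 1)) := by
  have hm' : (0 : ℝ) < m := by exact_mod_cast hm
  have h1 : m * δ ^ 2 < 1 := by
    have := mul_lt_mul_of_pos_left hcase hm'
    have h3 : (m : ℝ) * -(1 / m) = -1 := by field_simp
    nlinarith
  have ha : 0 < m * δ ^ 2 := by positivity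
  have h1m : (1 : ℝ) ≤ m := by exact_mod_cast hm
  have hd : δ ^ 2 < 1 := by nlinarith [sq_nonneg δ]
  rcases Nat.eq_or_lt_of_le hm with rfl | hm2
  · refine ⟨⟨by simp, ha.le, by simp, by unfold gain; simp at *; linarith, by simp,
      by simp [gain]⟩, ha, by simp, fun _ r hr1 hr2 => ?_, by simp⟩
    simp; nlinarith
  · have h2m : (2 : ℝ) ≤ m := by exact_mod_cast hm2
    have hm1 : (0 : ℝ) < m - 1 := by linarith
    have hb : 0 < (m : ℝ) * (1 - δ ^ 2) / (m - 1) := by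
      have : 0 < 1 - δ ^ 2 := by linarith
      positivity
    have hbeq : (m : ℝ) * (1 - δ ^ 2) / (m - 1) * (m - 1) = m * (1 - δ ^ 2) := by field_simp
    have hgain : gain m = m / (m - 1) := by unfold gain; rw [if_neg (by omega)]
    set b := (m : ℝ) * (1 - δ ^ 2) / (m - 1) with hbdef
    have hab : m * δ ^ 2 ≤ b := by nlinarith
    have hbg : b ≤ gain m := by
      rw [hgain, hbdef]; gcongr; nlinarith [sq_nonneg δ]
    refine ⟨⟨by simp, ha.le, by nlinarith, hab.trans hbg, hb.le, hbg⟩, ha, fun _ => hb,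
      fun h => by omega, fun _ r hr1 hr2 => ?_⟩
    have hr : r ^ 2 ≤ δ ^ 2 := by nlinarith
    have hz : δ ^ 2 * b + (1 - δ ^ 2) * (m * δ ^ 2) = m * δ ^ 2 * b := by
      linear_combination (-δ ^ 2) * hbeq
    have : (r ^ 2 - δ ^ 2) * (b - m * δ ^ 2) ≤ 0 :=
      mul_nonpos_of_nonpos_of_nonneg (by linarith) (by linarith)
    nlinarith

set_option maxHeartbeats 400000 in
-- `ξ` is the smaller root of a quadratic `f`. The signs of `f` at `0`, `γ` and the midpoint of the
-- slab place it to the right of `0` and `γ` and not beyond the midpoint. The defect in the covering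
-- inequality equals `(b - a)(r - γ)(r - δ)`: the ellipsoid passes through the rims of both end
-- sections and, as `a ≤ b`, covers everything between them.
theorem slabCover_generic {m : ℕ} (hm : 1 ≤ m) {γ δ : ℝ} (hγ : -1 < γ) (hδ : δ ≤ 1)
    (hlt : γ < δ) (hσ : 0 < γ + δ) (hcase : -(1 / (m : ℝ)) < γ * δ) {ξ : ℝ}
    (hroot : (m + 1) * (γ + δ) * ξ ^ 2 - (m * (γ + δ) ^ 2 + 2 * (1 + γ * δ)) * ξ +
      (γ + δ) * (1 + m * (γ * δ)) = 0)
    (hleft : 2 * (m + 1) * (γ + δ) * ξ ≤ m * (γ + δ) ^ 2 + 2 * (1 + γ * δ)) :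
    SlabCover m γ δ ξ (m * (ξ - γ) * (δ - ξ))
      ((m * (ξ - γ) * (δ - ξ) - m * (ξ - γ) * (δ - ξ) * γ ^ 2) /
        (m * (ξ - γ) * (δ - ξ) - (ξ - γ) ^ 2)) := by
  have hm' : (1 : ℝ) ≤ m := by exact_mod_cast hm
  have hp : 0 < 1 + m * (γ * δ) := by
    have := mul_lt_mul_of_pos_left hcase (by linarith : (0 : ℝ) < m)
    have h3 : (m : ℝ) * -(1 / m) = -1 := by field_simp
    linarith
  have hp1 : 0 < 1 + γ * δ := by
    by_contra! h
    have := mul_le_mul hm' (show 1 ≤ -(γ * δ) by linarith) zero_le_one (by linarith)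
    linarith
  have hγ1 : γ < 1 := by linarith
  have hγ2 : 0 < 1 - γ ^ 2 := by nlinarith
  set σ := γ + δ with hσdef
  set B := m * σ ^ 2 + 2 * (1 + γ * δ) with hB
  have hBpos : 0 < B := by positivity
  have hf : ∀ r : ℝ, (m + 1) * σ * r ^ 2 - B * r + σ * (1 + m * (γ * δ)) =
      (r - ξ) * ((m + 1) * σ * (r + ξ) - B) := fun r => by linear_combination hroot
  have hcoef : 0 < (m + 1) * σ := by positivity
  have hmid : (σ / 2 - ξ) * ((m + 1) * σ * (σ / 2 + ξ) - B) ≤ 0 := by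
    rw [← hf, hB, hσdef]
    have : (m + 1) * (γ + δ) * ((γ + δ) / 2) ^ 2 - (m * (γ + δ) ^ 2 + 2 * (1 + γ * δ)) * ((γ + δ) / 2)
      + (γ + δ) * (1 + m * (γ * δ)) = -((γ + δ) * (m - 1) * (δ - γ) ^ 2 / 4) := by ring
    rw [this]
    have h1 : (0 : ℝ) ≤ m - 1 := by linarith
    have : 0 ≤ (γ + δ) * (m - 1) * (δ - γ) ^ 2 / 4 := by positivity
    linarith
  have hξmid : ξ ≤ σ / 2 := by
    by_contra! hc
    have h1 : 0 ≤ (m + 1) * σ * (σ / 2 + ξ) - B := by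
      by_contra! h
      linarith [mul_pos_of_neg_of_neg (show σ / 2 - ξ < 0 by linarith) h]
    linarith [mul_pos hcoef (show 0 < ξ - σ / 2 by linarith)]
  have hξpos : 0 < ξ := by
    by_contra! hc
    have h0 := hf 0
    have h1 : 0 < σ * (1 + m * (γ * δ)) := by positivity
    have h2 : (m + 1) * σ * ξ ≤ 0 := mul_nonpos_of_nonneg_of_nonpos hcoef.le hc
    have h3 : (0 - ξ) * ((m + 1) * σ * (0 + ξ) - B) ≤ 0 :=
      mul_nonpos_of_nonneg_of_nonpos (by linarith) (by rw [zero_add]; linarith)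
    linarith
  have hξγ : γ < ξ := by
    by_contra! hc
    have h0 : (γ - ξ) * ((m + 1) * σ * (γ + ξ) - B) = (δ - γ) * (1 - γ ^ 2) := by
      rw [← hf, hB, hσdef]; ring
    have h1 : 0 < (δ - γ) * (1 - γ ^ 2) := mul_pos (by linarith) hγ2
    have hγσ : γ < σ / 2 := by linarith
    have h2 : (m + 1) * σ * (σ / 2 + ξ) - B ≤ 0 := by
      by_contra! h
      linarith [mul_pos (show 0 < σ / 2 - ξ by linarith) h]
    have h3 : (m + 1) * σ * γ ≤ (m + 1) * σ * (σ / 2) := by gcongr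
    have h4 : (γ - ξ) * ((m + 1) * σ * (γ + ξ) - B) ≤ 0 :=
      mul_nonpos_of_nonneg_of_nonpos (by linarith) (by linarith)
    linarith
  have hξδ : ξ < δ := by linarith
  have hα : 0 < ξ - γ := by linarith
  have hκ : 0 < δ - ξ := by linarith
  have ha : 0 < m * (ξ - γ) * (δ - ξ) := by positivity
  have hale : m * (ξ - γ) * (δ - ξ) ≤ m * ((δ - γ) / 2) ^ 2 := by
    rw [mul_assoc]; gcongr; nlinarith [sq_nonneg (ξ - γ - (δ - ξ))]
  have hξabs : |ξ| ≤ 1 := by rw [abs_le]; constructor <;> linarith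
  rcases Nat.eq_or_lt_of_le hm with rfl | hm2
  · have hξeq : ξ = σ / 2 := by
      have h1 : (2 * ξ - σ) * (σ * ξ - (1 + γ * δ)) = 0 := by
        simp only [Nat.cast_one, hB] at hroot; linear_combination hroot
      rcases mul_eq_zero.mp h1 with h | h
      · linarith
      · have h4 : δ ^ 2 ≤ 1 := by rw [sq_le_one_iff_abs_le_one, abs_le]; constructor <;> linarith
        have h5 : σ * (σ - 2 * ξ) = γ ^ 2 + δ ^ 2 - 2 := by
          rw [hσdef] at h ⊢; linear_combination (-2) * h
        have : σ - 2 * ξ ≤ 0 := by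
          by_contra! h
          linarith [mul_pos hσ h]
        linarith
    have hαeq : ξ - γ = (δ - γ) / 2 := by linarith
    have hκeq : δ - ξ = (δ - γ) / 2 := by linarith
    simp only [Nat.cast_one, one_mul, hαeq, hκeq]
    -- The denominator of `b` vanishes for `m = 1`, so `b` takes the default value `0`.
    have hz : (δ - γ) / 2 * ((δ - γ) / 2) - ((δ - γ) / 2) ^ 2 = 0 := by ring
    rw [hz, div_zero]
    refine ⟨⟨hξabs, by positivity, by rw [Nat.cast_one, one_mul, sq],
      by rw [gain, if_pos rfl]; exact mul_le_one₀ (by linarith) (by linarith) (by linarith),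
      le_rfl, by simp [gain]⟩,
      mul_pos (by linarith) (by linarith), by simp, fun _ r h1 h2 => ?_, by simp⟩
    have h3 : r - ξ ≤ (δ - γ) / 2 := by linarith
    have h4 : -((δ - γ) / 2) ≤ r - ξ := by linarith
    rw [← sq]
    exact sq_le_sq' h4 h3
  · have h2m : (2 : ℝ) ≤ m := by exact_mod_cast hm2
    have hden : 0 < m * (δ - ξ) - (ξ - γ) := by
      have : 2 * (δ - ξ) ≤ m * (δ - ξ) := by gcongr
      linarith
    have hden' : m * (ξ - γ) * (δ - ξ) - (ξ - γ) ^ 2 = (ξ - γ) * (m * (δ - ξ) - (ξ - γ)) := by ring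
    have hdenpos : 0 < m * (ξ - γ) * (δ - ξ) - (ξ - γ) ^ 2 := by rw [hden']; positivity
    set a := m * (ξ - γ) * (δ - ξ) with hadef
    set b := (a - a * γ ^ 2) / (a - (ξ - γ) ^ 2) with hbdef
    have hbeq : b * (a - (ξ - γ) ^ 2) = a - a * γ ^ 2 := by
      rw [hbdef]; exact div_mul_cancel₀ _ hdenpos.ne'
    have hb : 0 < b := by
      rw [hbdef, show a - a * γ ^ 2 = a * (1 - γ ^ 2) by ring]
      exact div_pos (mul_pos ha hγ2) hdenpos
    have hbeq2 : b * (m * (δ - ξ) - (ξ - γ)) = m * (δ - ξ) * (1 - γ ^ 2) := by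
      have : (ξ - γ) * (b * (m * (δ - ξ) - (ξ - γ)) - m * (δ - ξ) * (1 - γ ^ 2)) = 0 := by
        rw [hden'] at hbeq
        linear_combination hbeq + (1 - γ ^ 2) * hadef
      rcases mul_eq_zero.mp this with h | h
      · linarith
      · linarith
    -- The equation for `ξ` says exactly that the rim at `δ` is on the boundary too; the rim at `γ`
    -- is there by the definition of `b`.
    have hkey : b * (σ - 2 * ξ) = a * σ := by
      have : (m * (δ - ξ) - (ξ - γ)) * (b * (σ - 2 * ξ) - a * σ) = 0 := by
        rw [hadef]
        linear_combination (σ - 2 * ξ) * hbeq2 + m * (δ - ξ) * hroot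
      rcases mul_eq_zero.mp this with h | h
      · linarith
      · linarith
    have hab : a ≤ b := by
      have h1 : σ * (b - a) = 2 * (ξ * b) := by linear_combination hkey
      have h2 : 0 ≤ σ * (b - a) := by rw [h1]; positivity
      linarith [nonneg_of_mul_nonneg_right h2 hσ]
    have hbg : b ≤ gain m := by
      unfold gain
      rw [if_neg (by omega), le_div_iff₀ (by linarith)]
      have h1 : m * (δ - ξ) * (1 - γ ^ 2) ≤ m * (δ - ξ) := by
        have : 0 ≤ m * (δ - ξ) * γ ^ 2 := by positivity
        linarith
      have h2 : (m - 1) * (δ - ξ) ≤ m * (δ - ξ) - (ξ - γ) := by linarith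
      have h3 : b * ((m - 1) * (δ - ξ)) ≤ m * (δ - ξ) :=
        (mul_le_mul_of_nonneg_left h2 hb.le).trans (hbeq2.le.trans h1)
      exact le_of_mul_le_mul_right (by linarith) hκ
    refine ⟨⟨hξabs, ha.le, hale, hab.trans hbg, hb.le, hbg⟩, ha, fun _ => hb, fun h => by omega,
      fun _ r h1 h2 => ?_⟩
    have hid : (r - ξ) ^ 2 * b + (1 - r ^ 2) * a - a * b = (b - a) * ((r - γ) * (r - δ)) := by
      linear_combination (r - γ) * hkey - hbeq
    have : (b - a) * ((r - γ) * (r - δ)) ≤ 0 :=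
      mul_nonpos_of_nonneg_of_nonpos (by linarith)
        (mul_nonpos_of_nonneg_of_nonpos (by linarith) (by linarith))
    linarith

theorem slabParamsAux_cover {m : ℕ} (hm : 1 ≤ m) {γ δ : ℝ} (hγ : -1 ≤ γ) (hδ : δ ≤ 1)
    (hlt : γ < δ) (habs : |γ| ≤ |δ|) :
    SlabCover m γ δ (slabParamsAux m γ δ).1 (slabParamsAux m γ δ).2.1
      (slabParamsAux m γ δ).2.2 := by
  have hm' : (1 : ℝ) ≤ m := by exact_mod_cast hm
  have hδ0 : 0 < δ := by
    by_contra! h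
    rw [abs_of_nonpos h, abs_of_neg (by linarith)] at habs
    linarith
  have hσ : 0 ≤ γ + δ := by
    rw [abs_of_pos hδ0] at habs
    linarith [neg_abs_le γ]
  unfold slabParamsAux
  split_ifs with h1 h2
  · exact slabCover_unit hm hγ hδ h1
  · have : γ = -δ := by linarith
    subst this
    exact slabCover_symm hm hδ0 (not_le.mp h1)
  · rw [not_le] at h1
    have hσ' : 0 < γ + δ := lt_of_le_of_ne hσ (Ne.symm h2)
    have hγ' : -1 < γ := by linarith
    set D : ℝ := (m : ℝ) ^ 2 * (δ ^ 2 - γ ^ 2) ^ 2 + 4 * (1 - γ ^ 2) * (1 - δ ^ 2) with hD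
    have hDnn : 0 ≤ D := by
      have h3 : 0 ≤ 1 - γ ^ 2 := by nlinarith
      have h4 : 0 ≤ 1 - δ ^ 2 := by nlinarith
      positivity
    have hsq : √D ^ 2 = D := Real.sq_sqrt hDnn
    have hsn := Real.sqrt_nonneg D
    dsimp only
    set ξ : ℝ := (m * (γ + δ) ^ 2 + 2 * (1 + γ * δ) - √D) / (2 * (m + 1) * (γ + δ)) with hξ
    have hξeq : 2 * (m + 1) * (γ + δ) * ξ = m * (γ + δ) ^ 2 + 2 * (1 + γ * δ) - √D := by
      rw [hξ]; field_simp
    refine slabCover_generic hm hγ' hδ hlt hσ' h1 ?_ (by linarith)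
    have h4 : (4 * (m + 1) * (γ + δ)) * ((m + 1) * (γ + δ) * ξ ^ 2 -
        (m * (γ + δ) ^ 2 + 2 * (1 + γ * δ)) * ξ + (γ + δ) * (1 + m * (γ * δ))) = 0 := by
      have h5 : √D = m * (γ + δ) ^ 2 + 2 * (1 + γ * δ) - 2 * (m + 1) * (γ + δ) * ξ := by linarith
      rw [h5, hD] at hsq
      linear_combination hsq
    rcases mul_eq_zero.mp h4 with h | h
    · exfalso
      have : 0 < 4 * (m + 1) * (γ + δ) := by positivity
      linarith
    · exact h

/-- After decoding errors the slab may miss the ellipsoid, and both ends are clipped to the same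
number. Nothing need be covered then, but the shape bounds must persist. Here `a = 0`, and in the
generic branch `D` is a perfect square, `ξ = γ`, and `b = 0 / 0 = 0`. -/
theorem slabParamsAux_bounds_self {m : ℕ} (hm : 1 ≤ m) {γ : ℝ} (hγ : -1 ≤ γ) (hδ : γ ≤ 1) :
    SlabBounds m γ γ (slabParamsAux m γ γ).1 (slabParamsAux m γ γ).2.1
      (slabParamsAux m γ γ).2.2 := by
  have hm' : (1 : ℝ) ≤ m := by exact_mod_cast hm
  have hg := one_le_gain hm
  unfold slabParamsAux
  split_ifs with h1 h2
  · exfalso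
    have : 0 < 1 / (m : ℝ) := by positivity
    nlinarith
  · have : γ = 0 := by linarith
    subst this
    refine ⟨by simp, by simp, by simp, by simp; linarith, ?_, ?_⟩
    · have : (0 : ℝ) ≤ m - 1 := by linarith
      simp; positivity
    · unfold gain; split_ifs with h
      · subst h; simp
      · simp
  · dsimp only
    have hγ0 : γ ≠ 0 := fun h => h2 (by rw [h]; simp)
    have hD : (m : ℝ) ^ 2 * (γ ^ 2 - γ ^ 2) ^ 2 + 4 * (1 - γ ^ 2) * (1 - γ ^ 2) =
      (2 * (1 - γ ^ 2)) ^ 2 := by ring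
    have h0 : 0 ≤ 2 * (1 - γ ^ 2) := by nlinarith
    rw [hD, Real.sqrt_sq h0]
    have hξ : ((m : ℝ) * (γ + γ) ^ 2 + 2 * (1 + γ * γ) - 2 * (1 - γ ^ 2)) /
        (2 * (m + 1) * (γ + γ)) = γ := by
      rw [div_eq_iff (by positivity)]; ring
    rw [hξ]
    refine ⟨abs_le.mpr ⟨hγ, hδ⟩, by simp, by simp, by simp; linarith, by simp, by simp; linarith⟩

theorem slabParams_cover {m : ℕ} (hm : 1 ≤ m) {γ δ : ℝ} (hγ : -1 ≤ γ) (hδ : δ ≤ 1)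
    (hlt : γ < δ) :
    SlabCover m γ δ (slabParams m γ δ).1 (slabParams m γ δ).2.1 (slabParams m γ δ).2.2 := by
  unfold slabParams
  split_ifs with h
  · exact slabParamsAux_cover hm hγ hδ hlt h
  · refine SlabCover.reflect (slabParamsAux_cover hm (by linarith) (by linarith) (by linarith) ?_)
    rw [abs_neg, abs_neg]
    exact (not_le.mp h).le

theorem slabParams_bounds {m : ℕ} (hm : 1 ≤ m) {γ δ : ℝ} (hγ : -1 ≤ γ) (hδ : δ ≤ 1)
    (hle : γ ≤ δ) :
    SlabBounds m γ δ (slabParams m γ δ).1 (slabParams m γ δ).2.1 (slabParams m γ δ).2.2 := by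
  rcases hle.eq_or_lt with rfl | hlt
  · unfold slabParams
    rw [if_pos le_rfl]
    exact slabParamsAux_bounds_self hm hγ hδ
  · exact (slabParams_cover hm hγ hδ hlt).toSlabBounds

theorem neg_one_le_clip (r : ℝ) : -1 ≤ clip r := le_max_left _ _

theorem clip_le_one (r : ℝ) : clip r ≤ 1 := max_le (by norm_num) (min_le_left _ _)

theorem clip_mono {r s : ℝ} (h : r ≤ s) : clip r ≤ clip s := by
  unfold clip; gcongr

theorem clip_sub_le {r s : ℝ} (h : r ≤ s) : clip s - clip r ≤ s - r := by
  unfold clip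
  rcases le_total 1 s with h1 | h1 <;> rcases le_total 1 r with h2 | h2 <;>
    rcases le_total (-1) s with h3 | h3 <;> rcases le_total (-1) r with h4 | h4 <;>
    simp [*] <;> linarith

theorem clip_le_of_le {r s : ℝ} (h : r ≤ s) (hs : -1 ≤ s) : clip r ≤ s :=
  max_le hs ((min_le_right _ _).trans h)

theorem le_clip_of_le {r s : ℝ} (h : r ≤ s) (hr : r ≤ 1) : r ≤ clip s :=
  le_max_of_le_right (le_min hr h)

/-- A slab with a point of the ellipsoid strictly inside stays nondegenerate after clipping, so
`slabParams_cover` applies to it. -/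
theorem clip_lt_clip {r s x : ℝ} (h1 : r < x) (h2 : x < s) (hx : |x| ≤ 1) : clip r < clip s := by
  obtain ⟨h3, h4⟩ := abs_le.mp hx
  unfold clip
  rcases le_total 1 s with h5 | h5 <;> rcases le_total (-1) r with h6 | h6
  · rw [min_eq_left h5, min_eq_right (by linarith), max_eq_right h6, max_eq_right (by norm_num)]
    linarith
  · rw [min_eq_left h5, min_eq_right (by linarith), max_eq_left h6, max_eq_right (by norm_num)]
    norm_num
  · rw [min_eq_right h5, min_eq_right (by linarith), max_eq_right h6, max_eq_right (by linarith)]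
    linarith
  · rw [min_eq_right h5, min_eq_right (by linarith), max_eq_left h6, max_eq_right (by linarith)]
    linarith

/-! ### Quadratic forms -/

section QuadraticForms

variable {m : ℕ} {P : Matrix (Fin m) (Fin m) ℝ}

/-- The quadratic form of a matrix. -/
noncomputable def quad (P : Matrix (Fin m) (Fin m) ℝ) (z : Fin m → ℝ) : ℝ := z ⬝ᵥ (P *ᵥ z)

/-- Half the width of `𝓔(P, c)` in direction `z`. -/
noncomputable def width (P : Matrix (Fin m) (Fin m) ℝ) (z : Fin m → ℝ) : ℝ := √(quad P z)

/-- Symmetric matrices with nonnegative quadratic form. -/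
structure NonnegForm (P : Matrix (Fin m) (Fin m) ℝ) : Prop where
  symm : Pᵀ = P
  nonneg : ∀ z, 0 ≤ quad P z

/-- Symmetric matrices with positive quadratic form. -/
structure PosForm (P : Matrix (Fin m) (Fin m) ℝ) : Prop where
  symm : Pᵀ = P
  pos : ∀ z, z ≠ 0 → 0 < quad P z

theorem PosForm.nonnegForm (hP : PosForm P) : NonnegForm P where
  symm := hP.symm
  nonneg z := by
    by_cases hz : z = 0
    · simp [hz, quad]
    · exact (hP.pos z hz).le

theorem posForm_of_posDef (hP : P.PosDef) : PosForm P where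
  symm := by rw [← conjTranspose_eq_transpose_of_trivial]; exact hP.isHermitian.eq
  pos z hz := by simpa [quad] using hP.dotProduct_mulVec_pos hz

theorem PosForm.posDef (hP : PosForm P) : P.PosDef :=
  PosDef.of_dotProduct_mulVec_pos
    (by rw [IsHermitian, conjTranspose_eq_transpose_of_trivial]; exact hP.symm)
    fun z hz => by simpa [quad] using hP.pos z hz

theorem dotProduct_mulVec_symm (hP : Pᵀ = P) (x y : Fin m → ℝ) :
    x ⬝ᵥ (P *ᵥ y) = y ⬝ᵥ (P *ᵥ x) := by
  rw [dotProduct_mulVec, ← mulVec_transpose, hP, dotProduct_comm]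

theorem quad_add (hP : Pᵀ = P) (x y : Fin m → ℝ) :
    quad P (x + y) = quad P x + 2 * (x ⬝ᵥ (P *ᵥ y)) + quad P y := by
  simp only [quad, mulVec_add, dotProduct_add, add_dotProduct]
  rw [dotProduct_mulVec_symm hP y x]; ring

theorem quad_smul (t : ℝ) (x : Fin m → ℝ) : quad P (t • x) = t ^ 2 * quad P x := by
  simp only [quad, mulVec_smul, dotProduct_smul, smul_dotProduct, smul_eq_mul]; ring

theorem NonnegForm.cauchy_schwarz (hP : NonnegForm P) (x y : Fin m → ℝ) :
    (x ⬝ᵥ (P *ᵥ y)) ^ 2 ≤ quad P x * quad P y := by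
  have h : ∀ t : ℝ, 0 ≤ quad P y * (t * t) + 2 * (x ⬝ᵥ (P *ᵥ y)) * t + quad P x := fun t => by
    have := hP.nonneg (x + t • y)
    rw [quad_add hP.symm, quad_smul, mulVec_smul, dotProduct_smul, smul_eq_mul] at this
    linarith
  have := discrim_le_zero h
  rw [discrim] at this
  linarith

theorem width_nonneg (z : Fin m → ℝ) : 0 ≤ width P z := Real.sqrt_nonneg _

theorem NonnegForm.width_sq (hP : NonnegForm P) (z : Fin m → ℝ) : width P z ^ 2 = quad P z :=
  Real.sq_sqrt (hP.nonneg z)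

theorem width_smul (t : ℝ) (z : Fin m → ℝ) : width P (t • z) = |t| * width P z := by
  rw [width, quad_smul, Real.sqrt_mul (sq_nonneg t), Real.sqrt_sq_eq_abs, width]

theorem width_zero : width P 0 = 0 := by simp [width, quad]

theorem NonnegForm.abs_dotProduct_le (hP : NonnegForm P) (x y : Fin m → ℝ) :
    |x ⬝ᵥ (P *ᵥ y)| ≤ width P x * width P y := by
  apply abs_le_of_sq_le_sq
  · rw [mul_pow, hP.width_sq, hP.width_sq]; exact hP.cauchy_schwarz x y
  · exact mul_nonneg (width_nonneg x) (width_nonneg y)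

/-- With `width_smul` this makes `width P` a seminorm, so the filter can be analysed direction by
direction. -/
theorem NonnegForm.width_add_le (hP : NonnegForm P) (x y : Fin m → ℝ) :
    width P (x + y) ≤ width P x + width P y := by
  apply Real.sqrt_le_iff.mpr
  refine ⟨add_nonneg (width_nonneg x) (width_nonneg y), ?_⟩
  rw [quad_add hP.symm, ← hP.width_sq, ← hP.width_sq]
  have := le_of_abs_le (hP.abs_dotProduct_le x y)
  linarith

theorem quad_one (z : Fin m → ℝ) : quad 1 z = z ⬝ᵥ z := by rw [quad, one_mulVec]

theorem nonnegForm_one : NonnegForm (1 : Matrix (Fin m) (Fin m) ℝ) where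
  symm := transpose_one
  nonneg z := by
    rw [quad_one]
    exact Finset.sum_nonneg fun i _ => mul_self_nonneg _

theorem dotProduct_self_le_of_norm_le {w : Fin m → ℝ} {r : ℝ} (hw : ‖w‖ ≤ r) :
    w ⬝ᵥ w ≤ m * r ^ 2 := by
  have : ∀ i ∈ Finset.univ, w i * w i ≤ r ^ 2 := fun i _ => by
    have h1 := (norm_le_pi_norm w i).trans hw
    rw [Real.norm_eq_abs] at h1
    have := abs_le.mp h1
    nlinarith
  calc w ⬝ᵥ w ≤ ∑ _i : Fin m, r ^ 2 := Finset.sum_le_sum this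
    _ = m * r ^ 2 := by simp

end QuadraticForms

/-! ### The ellipsoidal filter in terms of widths -/

section Filter

variable {m mu : ℕ}

/-- The description of `x ∈ 𝓔(P, c)` by supporting half spaces. -/
def Ellipsoid.Encloses (E : Ellipsoid m) (x : Fin m → ℝ) : Prop :=
  ∀ z, (z ⬝ᵥ (x - E.center)) ^ 2 ≤ quad E.shape z

/-- Cauchy–Schwarz gives one direction, testing with `z = P⁻¹ (x - c)` the other. The half space
form needs no inverse, so it passes through measurement updates, whose shapes are only known to be
nonnegative. -/
theorem Ellipsoid.mem_carrier_iff {E : Ellipsoid m} (hE : PosForm E.shape) (x : Fin m → ℝ) :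
    x ∈ E.carrier ↔ E.Encloses x := by
  have hdet : IsUnit E.shape.det := hE.posDef.det_pos.ne'.isUnit
  have hinv : E.shape *ᵥ (E.shape⁻¹ *ᵥ (x - E.center)) = x - E.center := by
    rw [mulVec_mulVec, mul_nonsing_inv _ hdet, one_mulVec]
  set d := x - E.center with hd
  set y := E.shape⁻¹ *ᵥ d with hy
  have hq : quad E.shape y = d ⬝ᵥ y := by rw [quad, hinv, dotProduct_comm]
  constructor
  · intro h z
    have h1 : d ⬝ᵥ y ≤ 1 := h
    have h2 := hE.nonnegForm.cauchy_schwarz z y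
    rw [hinv, hq] at h2
    have h3 := hE.nonnegForm.nonneg z
    rw [← hd]
    nlinarith
  · intro h
    have h1 := h y
    rw [← hd, hq, dotProduct_comm] at h1
    change d ⬝ᵥ y ≤ 1
    have h2 := hE.nonnegForm.nonneg y
    rw [hq] at h2
    by_contra! h3
    nlinarith

theorem Ellipsoid.Encloses.abs_dotProduct_le {E : Ellipsoid m} {x : Fin m → ℝ} (h : E.Encloses x)
    (z : Fin m → ℝ) : |z ⬝ᵥ (x - E.center)| ≤ width E.shape z :=
  Real.abs_le_sqrt (h z)

/-- The coordinate of `z` along the measured direction, relative to the form of `E`. -/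
noncomputable def Ellipsoid.coord (E : Ellipsoid m) (h z : Fin m → ℝ) : ℝ :=
  (z ⬝ᵥ (E.shape *ᵥ h)) / √(quad E.shape h)

theorem Ellipsoid.coord_sq_le {E : Ellipsoid m} (hE : PosForm E.shape) {h : Fin m → ℝ}
    (hh : h ≠ 0) (z : Fin m → ℝ) : E.coord h z ^ 2 ≤ quad E.shape z := by
  have hq := hE.pos h hh
  rw [coord, div_pow, Real.sq_sqrt hq.le, div_le_iff₀ hq]
  exact hE.nonnegForm.cauchy_schwarz z h

theorem Ellipsoid.coord_self {E : Ellipsoid m} (hE : PosForm E.shape) {h : Fin m → ℝ}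
    (hh : h ≠ 0) : E.coord h h ^ 2 = quad E.shape h := by
  have hq := hE.pos h hh
  rw [coord, div_pow, Real.sq_sqrt hq.le, ← quad, sq, mul_div_assoc, div_self hq.ne', mul_one]

/-- In dimension one every `z` is a multiple of `h`, so the transversal part of the form, which
carries the factor `b`, is zero. -/
theorem Ellipsoid.coord_sq_eq_of_one {E : Ellipsoid m} (hm : m = 1) (hE : PosForm E.shape)
    {h : Fin m → ℝ} (hh : h ≠ 0) (z : Fin m → ℝ) : E.coord h z ^ 2 = quad E.shape z := by
  subst hm
  have h0 : h 0 ≠ 0 := fun h0 => hh (funext fun i => by rw [Subsingleton.elim i 0, h0]; rfl)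
  have hz : z = (z 0 / h 0) • h := funext fun i => by
    rw [Subsingleton.elim i 0]; simp [h0]
  rw [hz, quad_smul, ← E.coord_self hE hh, coord, coord, smul_dotProduct, smul_eq_mul]
  ring

/-- The parameters used by `Ellipsoid.measUpdate`. -/
noncomputable def Ellipsoid.slab (E : Ellipsoid m) (h : Fin m → ℝ) (lo hi : ℝ) : ℝ × ℝ × ℝ :=
  slabParams m (clip ((lo - h ⬝ᵥ E.center) / √(quad E.shape h)))
    (clip ((hi - h ⬝ᵥ E.center) / √(quad E.shape h)))

theorem Ellipsoid.measUpdate_shape (E : Ellipsoid m) (h : Fin m → ℝ) (lo hi : ℝ) :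
    (E.measUpdate h lo hi).shape = (E.slab h lo hi).2.2 • E.shape -
      (((E.slab h lo hi).2.2 - (E.slab h lo hi).2.1) / quad E.shape h) •
        vecMulVec (E.shape *ᵥ h) (h ᵥ* E.shape) := rfl

theorem Ellipsoid.measUpdate_center (E : Ellipsoid m) (h : Fin m → ℝ) (lo hi : ℝ) :
    (E.measUpdate h lo hi).center =
      E.center + ((E.slab h lo hi).1 / √(quad E.shape h)) • (E.shape *ᵥ h) := rfl

theorem Ellipsoid.slab_bounds (hm : 1 ≤ m) (E : Ellipsoid m) (h : Fin m → ℝ) {lo hi : ℝ}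
    (hle : lo ≤ hi) :
    SlabBounds m (clip ((lo - h ⬝ᵥ E.center) / √(quad E.shape h)))
      (clip ((hi - h ⬝ᵥ E.center) / √(quad E.shape h)))
      (E.slab h lo hi).1 (E.slab h lo hi).2.1 (E.slab h lo hi).2.2 :=
  slabParams_bounds hm (neg_one_le_clip _) (clip_le_one _) (clip_mono (by gcongr))

theorem Ellipsoid.quad_measUpdate {E : Ellipsoid m} (hE : PosForm E.shape) {h : Fin m → ℝ}
    (hh : h ≠ 0) (lo hi : ℝ) (z : Fin m → ℝ) :
    quad (E.measUpdate h lo hi).shape z =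
      (E.slab h lo hi).2.2 * (quad E.shape z - E.coord h z ^ 2) +
        (E.slab h lo hi).2.1 * E.coord h z ^ 2 := by
  have hq := hE.pos h hh
  rw [measUpdate_shape, quad, sub_mulVec, smul_mulVec, smul_mulVec, dotProduct_sub,
    dotProduct_smul, dotProduct_smul, vecMulVec_mulVec, ← quad, coord, div_pow,
    Real.sq_sqrt hq.le, ← mulVec_transpose, hE.symm]
  simp only [smul_eq_mul, op_smul_eq_smul, dotProduct_smul]
  rw [dotProduct_comm (E.shape *ᵥ h) z]
  ring

theorem Ellipsoid.measUpdate_nonnegForm (hm : 1 ≤ m) {E : Ellipsoid m} (hE : PosForm E.shape)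
    {h : Fin m → ℝ} (hh : h ≠ 0) {lo hi : ℝ} (hle : lo ≤ hi) :
    NonnegForm (E.measUpdate h lo hi).shape where
  symm := by
    rw [measUpdate_shape, transpose_sub, transpose_smul, transpose_smul, transpose_vecMulVec,
      hE.symm, ← mulVec_transpose, hE.symm]
  nonneg z := by
    rw [quad_measUpdate hE hh]
    have hb := E.slab_bounds hm h hle
    exact add_nonneg (mul_nonneg hb.b_nonneg (sub_nonneg.mpr (coord_sq_le hE hh z)))
      (mul_nonneg hb.a_nonneg (sq_nonneg _))

/-- By `quad_measUpdate` the form splits into a part along `h` scaled by `a` and a transversal part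
scaled by `b`, and neither factor exceeds `gain m`. -/
theorem Ellipsoid.width_measUpdate_le (hm : 1 ≤ m) {E : Ellipsoid m} (hE : PosForm E.shape)
    {h : Fin m → ℝ} (hh : h ≠ 0) {lo hi : ℝ} (hle : lo ≤ hi) (z : Fin m → ℝ) :
    width (E.measUpdate h lo hi).shape z ≤ √(gain m) * width E.shape z := by
  have hg := one_le_gain hm
  rw [width, width, ← Real.sqrt_mul (by linarith)]
  apply Real.sqrt_le_sqrt
  rw [quad_measUpdate hE hh]
  have hb := E.slab_bounds hm h hle
  have h1 := mul_le_mul_of_nonneg_right hb.b_le_gain (sub_nonneg.mpr (coord_sq_le hE hh z))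
  have h2 := mul_le_mul_of_nonneg_right hb.a_le_gain (sq_nonneg (E.coord h z))
  linarith

/-- Along `h` only the factor `a` acts, and clipping cannot lengthen the slab. The bound does not
involve `E`: each measurement resets this width, whatever the filter did before. -/
theorem Ellipsoid.width_measUpdate_self_le (hm : 1 ≤ m) {E : Ellipsoid m}
    (hE : PosForm E.shape) {h : Fin m → ℝ} (hh : h ≠ 0) {lo hi : ℝ} (hle : lo ≤ hi) :
    width (E.measUpdate h lo hi).shape h ≤ √m * ((hi - lo) / 2) := by
  have hb := E.slab_bounds hm h hle
  have hq := hE.pos h hh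
  have hsq := Real.sqrt_pos.mpr hq
  rw [width, quad_measUpdate hE hh, E.coord_self hE hh, sub_self, mul_zero, zero_add]
  rw [Real.sqrt_le_iff]
  refine ⟨mul_nonneg (Real.sqrt_nonneg _) (by linarith), ?_⟩
  rw [mul_pow, Real.sq_sqrt (Nat.cast_nonneg m)]
  set γ := clip ((lo - h ⬝ᵥ E.center) / √(quad E.shape h))
  set δ := clip ((hi - h ⬝ᵥ E.center) / √(quad E.shape h))
  have h0 : γ ≤ δ := clip_mono (by gcongr)
  have h1 : δ - γ ≤ (hi - lo) / √(quad E.shape h) := by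
    refine (clip_sub_le (by gcongr)).trans (le_of_eq ?_)
    rw [← sub_div]; congr 1; ring
  rw [le_div_iff₀ hsq] at h1
  calc (E.slab h lo hi).2.1 * quad E.shape h
      ≤ m * ((δ - γ) / 2) ^ 2 * √(quad E.shape h) ^ 2 := by
        rw [Real.sq_sqrt hq.le]; gcongr; exact hb.a_le
    _ = m * ((δ - γ) * √(quad E.shape h) / 2) ^ 2 := by ring
    _ ≤ m * ((hi - lo) / 2) ^ 2 := by
        have : 0 ≤ (δ - γ) * √(quad E.shape h) := mul_nonneg (by linarith) hsq.le
        gcongr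

/-! ### The covering property of the two filter updates. -/

theorem sq_le_of_forall_sq_le {e r N : ℝ} (h : ∀ t, (e + t * r) ^ 2 ≤ N + t ^ 2) :
    e ^ 2 ≤ N * (1 - r ^ 2) := by
  have h' : ∀ t : ℝ, 0 ≤ (1 - r ^ 2) * (t * t) + (-(2 * e * r)) * t + (N - e ^ 2) := fun t => by
    linarith [h t]
  have := discrim_le_zero h'
  rw [discrim] at this
  linarith

/-- Weighted Cauchy–Schwarz: the left side is at most `(b N + a μ²)(A²/a + C/b)`, and the second
factor is at most one by `h`. -/
theorem sq_le_of_slab {a b A C N e μ : ℝ} (ha : 0 < a) (hb : 0 < b) (hN : 0 ≤ N) (hC : 0 ≤ C)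
    (h : A ^ 2 * b + C * a ≤ a * b) (he : e ^ 2 ≤ N * C) :
    (μ * A + e) ^ 2 ≤ b * N + a * μ ^ 2 := by
  have hx : 0 ≤ a ^ 2 * (C * μ ^ 2) := by positivity
  have hy : 0 ≤ b ^ 2 * (N * A ^ 2) := by positivity
  have h1 : 2 * (a * b * (μ * A * e)) ≤ a ^ 2 * (C * μ ^ 2) + b ^ 2 * (N * A ^ 2) := by
    apply le_of_abs_le
    apply abs_le_of_sq_le_sq _ (by linarith)
    have h2 : (a * b * μ * A) ^ 2 * e ^ 2 ≤ (a * b * μ * A) ^ 2 * (N * C) := by gcongr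
    nlinarith [sq_nonneg (a ^ 2 * (C * μ ^ 2) - b ^ 2 * (N * A ^ 2))]
  have h3 : (a * b) * (μ * A + e) ^ 2 ≤ (b * N + a * μ ^ 2) * (A ^ 2 * b + C * a) := by
    have : a * b * e ^ 2 ≤ a * b * (N * C) := by gcongr
    linarith
  have h4 : (b * N + a * μ ^ 2) * (A ^ 2 * b + C * a) ≤ (b * N + a * μ ^ 2) * (a * b) := by
    gcongr
  have hab : 0 < a * b := by positivity
  exact le_of_mul_le_mul_left (by linarith) hab

theorem Ellipsoid.Encloses.measUpdate (hm : 1 ≤ m) {E : Ellipsoid m} (hE : PosForm E.shape)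
    {h : Fin m → ℝ} (hh : h ≠ 0) {lo hi : ℝ} {x : Fin m → ℝ} (hx : E.Encloses x)
    (hlo : lo < h ⬝ᵥ x) (hhi : h ⬝ᵥ x < hi) : (E.measUpdate h lo hi).Encloses x := by
  intro z
  have hq := hE.pos h hh
  have hs := Real.sqrt_pos.mpr hq
  have hssq : √(quad E.shape h) ^ 2 = quad E.shape h := Real.sq_sqrt hq.le
  rw [quad_measUpdate hE hh]
  set s := √(quad E.shape h) with hsdef
  set d := x - E.center with hd
  set r := (h ⬝ᵥ d) / s with hr
  set μ := E.coord h z with hμ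
  have hrabs : |r| ≤ 1 := by
    rw [hr, abs_div, abs_of_pos hs, div_le_one hs]
    exact hx.abs_dotProduct_le h
  have hlor : (lo - h ⬝ᵥ E.center) / s < r := by
    rw [hr, hd, dotProduct_sub]; gcongr
  have hhir : r < (hi - h ⬝ᵥ E.center) / s := by
    rw [hr, hd, dotProduct_sub]; gcongr
  have hcov : SlabCover m (clip ((lo - h ⬝ᵥ E.center) / s)) (clip ((hi - h ⬝ᵥ E.center) / s))
      (E.slab h lo hi).1 (E.slab h lo hi).2.1 (E.slab h lo hi).2.2 :=
    slabParams_cover hm (neg_one_le_clip _) (clip_le_one _) (clip_lt_clip hlor hhir hrabs)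
  have hr1 := (abs_le.mp hrabs)
  have hγr := clip_le_of_le hlor.le hr1.1
  have hrδ := le_clip_of_le hhir.le hr1.2
  have hcenter : z ⬝ᵥ (x - (E.measUpdate h lo hi).center) =
      μ * (r - (E.slab h lo hi).1) + (z ⬝ᵥ d - μ * r) := by
    rw [measUpdate_center, ← sub_sub, dotProduct_sub, dotProduct_smul, ← hd, hμ, coord, ← hsdef,
      smul_eq_mul]
    ring
  have hN : 0 ≤ quad E.shape z - μ ^ 2 := sub_nonneg.mpr (coord_sq_le hE hh z)
  have hC : 0 ≤ 1 - r ^ 2 := by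
    have := (sq_le_one_iff_abs_le_one r).mpr hrabs
    linarith
  have he : (z ⬝ᵥ d - μ * r) ^ 2 ≤ (quad E.shape z - μ ^ 2) * (1 - r ^ 2) := by
    apply sq_le_of_forall_sq_le
    intro t
    -- The multiple of `h` is chosen so that the tested direction has coordinate `t` along the
    -- measured direction and the same transversal part as `z`.
    have h1 := hx (z + ((t - μ) / s) • h)
    have hμs : z ⬝ᵥ (E.shape *ᵥ h) = μ * s := by
      rw [hμ, coord, ← hsdef]; field_simp
    rw [← hd, quad_add hE.symm, quad_smul, add_dotProduct, smul_dotProduct, mulVec_smul,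
      dotProduct_smul, hμs, ← hssq, smul_eq_mul, smul_eq_mul] at h1
    have h2 : z ⬝ᵥ d + (t - μ) / s * (h ⬝ᵥ d) = z ⬝ᵥ d - μ * r + t * r := by rw [hr]; ring
    have h3 : quad E.shape z + 2 * ((t - μ) / s * (μ * s)) + ((t - μ) / s) ^ 2 * s ^ 2 =
        quad E.shape z - μ ^ 2 + t ^ 2 := by field_simp; ring
    rwa [h2, h3] at h1
  rw [hcenter]
  rcases Nat.eq_or_lt_of_le hm with hm1 | hm2
  · have hz := E.coord_sq_eq_of_one hm1.symm hE hh z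
    rw [← hμ] at hz
    rw [← hz, sub_self, zero_mul] at he
    have he0 : z ⬝ᵥ d - μ * r = 0 := pow_eq_zero_iff two_ne_zero |>.mp (le_antisymm he (sq_nonneg _))
    rw [he0, ← hz, sub_self, mul_zero, zero_add, add_zero, mul_pow, mul_comm]
    gcongr
    exact hcov.cover_one hm1.symm r hγr hrδ
  · exact sq_le_of_slab hcov.a_pos (hcov.b_pos hm2) hN hC (hcov.cover hm2 r hγr hrδ) he

theorem Ellipsoid.quad_timeUpdate (S : Plant m mu) (ε : ℝ) (u : Fin mu → ℝ) (E : Ellipsoid m)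
    (z : Fin m → ℝ) :
    quad (E.timeUpdate S ε u).shape z = (1 + ε) * quad E.shape (z ᵥ* S.F) +
      ((1 + 1 / ε) * (m * (S.W / 2) ^ 2)) * (z ⬝ᵥ z) := by
  have h1 : z ⬝ᵥ ((S.F * E.shape * S.Fᵀ) *ᵥ z) = quad E.shape (z ᵥ* S.F) := by
    rw [quad, ← mulVec_mulVec, ← mulVec_mulVec, mulVec_transpose, dotProduct_mulVec]
  rw [quad, timeUpdate, add_mulVec, dotProduct_add, smul_mulVec, smul_mulVec, dotProduct_smul,
    dotProduct_smul, one_mulVec, h1, smul_eq_mul, smul_eq_mul]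

theorem Ellipsoid.timeUpdate_posForm (hm : 1 ≤ m) {S : Plant m mu} (hW : 0 < S.W) {ε : ℝ}
    (hε : 0 < ε) (u : Fin mu → ℝ) {E : Ellipsoid m} (hE : NonnegForm E.shape) :
    PosForm (E.timeUpdate S ε u).shape where
  symm := by
    rw [timeUpdate]
    simp only [transpose_add, transpose_smul, transpose_mul, transpose_one, transpose_transpose,
      hE.symm, Matrix.mul_assoc]
  pos z hz := by
    rw [quad_timeUpdate]
    have h1 := hE.nonneg (z ᵥ* S.F)
    have h2 : 0 < z ⬝ᵥ z := by
      have h3 : z ⬝ᵥ z ≠ 0 := fun h => hz (dotProduct_self_eq_zero.mp h)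
      have h4 := nonnegForm_one.nonneg z
      rw [quad_one] at h4
      exact lt_of_le_of_ne h4 h3.symm
    have h5 : (0 : ℝ) < m := by exact_mod_cast hm
    positivity

/-- The contribution of the process noise to the squared width of a predicted ellipsoid. -/
noncomputable def Plant.noiseGain (S : Plant m mu) (ε : ℝ) : ℝ :=
  (1 + 1 / ε) * (m * (S.W / 2) ^ 2)

theorem Ellipsoid.width_timeUpdate_le {S : Plant m mu} {ε : ℝ}
    (hε : 0 < ε) (u : Fin mu → ℝ) {E : Ellipsoid m} (hE : NonnegForm E.shape) (z : Fin m → ℝ) :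
    width (E.timeUpdate S ε u).shape z ≤
      √(1 + ε) * width E.shape (z ᵥ* S.F) + √(S.noiseGain ε) * width 1 z := by
  have hκ : 0 ≤ S.noiseGain ε := by unfold Plant.noiseGain; positivity
  rw [width, quad_timeUpdate, Real.sqrt_le_iff, ← quad_one z, ← Plant.noiseGain,
    ← hE.width_sq, ← nonnegForm_one.width_sq]
  have h1 := width_nonneg (P := E.shape) (z ᵥ* S.F)
  have h2 := width_nonneg (P := 1) z
  refine ⟨by positivity, ?_⟩
  rw [add_sq, mul_pow, mul_pow, Real.sq_sqrt hκ, Real.sq_sqrt (by linarith)]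
  have : 0 ≤ 2 * (√(1 + ε) * width E.shape (z ᵥ* S.F)) * (√(S.noiseGain ε) * width 1 z) := by
    positivity
  linarith

theorem Ellipsoid.Encloses.timeUpdate {S : Plant m mu} {ε : ℝ} (hε : 0 < ε) {u : Fin mu → ℝ}
    {E : Ellipsoid m} {x w : Fin m → ℝ} (hx : E.Encloses x) (hw : ‖w‖ ≤ S.W / 2) :
    (E.timeUpdate S ε u).Encloses (S.F *ᵥ x + S.G *ᵥ u + w) := by
  intro z
  have hc : z ⬝ᵥ (S.F *ᵥ x + S.G *ᵥ u + w - (E.timeUpdate S ε u).center) =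
      (z ᵥ* S.F) ⬝ᵥ (x - E.center) + z ⬝ᵥ w := by
    rw [Ellipsoid.timeUpdate]
    simp only [dotProduct_sub, dotProduct_add, dotProduct_mulVec]
    ring
  rw [hc, quad_timeUpdate]
  have h1 := hx (z ᵥ* S.F)
  have h2 : (z ⬝ᵥ w) ^ 2 ≤ (z ⬝ᵥ z) * (m * (S.W / 2) ^ 2) := by
    have h3 := nonnegForm_one.cauchy_schwarz z w
    rw [one_mulVec, quad_one, quad_one] at h3
    refine h3.trans (mul_le_mul_of_nonneg_left (dotProduct_self_le_of_norm_le hw) ?_)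
    rw [← quad_one]; exact nonnegForm_one.nonneg z
  set A := (z ᵥ* S.F) ⬝ᵥ (x - E.center)
  set B := z ⬝ᵥ w
  have h4 : (A + B) ^ 2 ≤ (1 + ε) * A ^ 2 + (1 + 1 / ε) * B ^ 2 := by
    have : (1 + ε) * A ^ 2 + (1 + 1 / ε) * B ^ 2 - (A + B) ^ 2 = (ε * A - B) ^ 2 / ε := by
      field_simp; ring
    have : 0 ≤ (ε * A - B) ^ 2 / ε := by positivity
    linarith
  have h5 : (1 + ε) * A ^ 2 ≤ (1 + ε) * quad E.shape (z ᵥ* S.F) := by gcongr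
  have h6 : (1 + 1 / ε) * B ^ 2 ≤ (1 + 1 / ε) * ((z ⬝ᵥ z) * (m * (S.W / 2) ^ 2)) := by gcongr
  linarith

end Filter

/-! ### Observability and controllability -/

section LinearSystems

variable {m mu : ℕ}

/-- The induction principle for observability: a linear condition that holds for all `h F^j` holds
in every direction. -/
theorem Observable.eq_top_of_mem {F : Matrix (Fin m) (Fin m) ℝ} {h : Fin m → ℝ}
    (hobs : Observable F h) (p : Submodule ℝ (Fin m → ℝ)) (hp : ∀ j : ℕ, h ᵥ* F ^ j ∈ p) :
    p = ⊤ := by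
  rw [Observable, rank_eq_finrank_span_row] at hobs
  have htop : Submodule.span ℝ
      (Set.range (Matrix.of fun (j : Fin m) (i : Fin m) => (h ᵥ* F ^ (j : ℕ)) i).row) = ⊤ :=
    Submodule.eq_top_of_finrank_eq (by rw [hobs]; simp)
  rw [eq_top_iff, ← htop, Submodule.span_le]
  rintro _ ⟨j, rfl⟩
  exact hp j

theorem Observable.ne_zero {F : Matrix (Fin m) (Fin m) ℝ} {h : Fin m → ℝ} (hm : 1 ≤ m)
    (hobs : Observable F h) : h ≠ 0 := by
  rintro rfl
  have := hobs.eq_top_of_mem ⊥ fun j => by simp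
  have h1 : (fun _ => 1 : Fin m → ℝ) ∈ (⊥ : Submodule ℝ (Fin m → ℝ)) := by rw [this]; trivial
  have h2 := congrFun ((Submodule.mem_bot ℝ).mp h1) ⟨0, hm⟩
  simp at h2

/-- The matrix `[G, F G, …, F^{m-1} G]`. -/
def ctrlMatrix (F : Matrix (Fin m) (Fin m) ℝ) (G : Matrix (Fin m) (Fin mu) ℝ) :
    Matrix (Fin m) (Fin m × Fin mu) ℝ :=
  Matrix.of fun (i : Fin m) (p : Fin m × Fin mu) => (F ^ (p.1 : ℕ) * G) i p.2

theorem Controllable.exists_right_inverse {F : Matrix (Fin m) (Fin m) ℝ}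
    {G : Matrix (Fin m) (Fin mu) ℝ} (hctrl : Controllable F G) :
    ∃ R : Matrix (Fin m × Fin mu) (Fin m) ℝ, ctrlMatrix F G * R = 1 := by
  have hrank : (ctrlMatrix F G).rank = m := hctrl
  have htop : LinearMap.range (ctrlMatrix F G).mulVecLin = ⊤ :=
    Submodule.eq_top_of_finrank_eq (by rw [← Matrix.rank, hrank]; simp)
  have hsurj := LinearMap.range_eq_top.mp htop
  choose U hU using fun i : Fin m => hsurj (Pi.single i 1)
  refine ⟨Matrix.of fun p i => U i p, ?_⟩
  ext a i
  have := congrFun (hU i) a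
  rw [Pi.single_apply] at this
  rw [one_apply, ← this]
  rfl

theorem ctrlMatrix_mulVec (F : Matrix (Fin m) (Fin m) ℝ) (G : Matrix (Fin m) (Fin mu) ℝ)
    (U : Fin m × Fin mu → ℝ) :
    ctrlMatrix F G *ᵥ U = ∑ j : Fin m, F ^ (j : ℕ) *ᵥ (G *ᵥ fun a => U (j, a)) := by
  ext i
  simp only [mulVec, dotProduct, ctrlMatrix, of_apply, Fintype.sum_prod_type, Finset.sum_apply]
  refine Finset.sum_congr rfl fun j _ => ?_
  have := congrFun (mulVec_mulVec (fun a => U (j, a)) (F ^ (j : ℕ)) G) i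
  simp only [mulVec, dotProduct] at this
  exact this.symm

/-- If all Markov parameters `h F^j G` vanished, observability would force `G = 0`, contrary to
controllability. -/
theorem exists_markov_ne_zero {F : Matrix (Fin m) (Fin m) ℝ} {G : Matrix (Fin m) (Fin mu) ℝ}
    {h : Fin m → ℝ} (hm : 1 ≤ m) (hobs : Observable F h) (hctrl : Controllable F G) :
    ∃ j : ℕ, (h ᵥ* F ^ j) ᵥ* G ≠ 0 := by
  by_contra! hc
  have htop := hobs.eq_top_of_mem (LinearMap.ker (vecMulLinear G)) fun j => hc j
  have hG : G = 0 := by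
    ext i a
    have h1 : (Pi.single i 1 : Fin m → ℝ) ∈ LinearMap.ker (vecMulLinear G) := by
      rw [htop]; trivial
    have h2 := congrFun (LinearMap.mem_ker.mp h1) a
    simpa using h2
  have h0 : ctrlMatrix F G = 0 := by ext i p; simp [ctrlMatrix, hG]
  obtain ⟨R, hR⟩ := hctrl.exists_right_inverse
  rw [h0, Matrix.zero_mul] at hR
  have := congrFun (congrFun hR ⟨0, hm⟩) ⟨0, hm⟩
  simp at this

/-- There is an input direction that reaches the output with some delay and unit gain. -/
theorem exists_relative_degree {F : Matrix (Fin m) (Fin m) ℝ} {G : Matrix (Fin m) (Fin mu) ℝ}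
    {h : Fin m → ℝ} (hm : 1 ≤ m) (hobs : Observable F h) (hctrl : Controllable F G) :
    ∃ (r : ℕ) (q : Fin mu → ℝ), (∀ j < r, (h ᵥ* F ^ j) ᵥ* G = 0) ∧
      ((h ᵥ* F ^ r) ᵥ* G) ⬝ᵥ q = 1 := by
  classical
  have hex := exists_markov_ne_zero hm hobs hctrl
  refine ⟨Nat.find hex, (((h ᵥ* F ^ Nat.find hex) ᵥ* G) ⬝ᵥ ((h ᵥ* F ^ Nat.find hex) ᵥ* G))⁻¹ •
    ((h ᵥ* F ^ Nat.find hex) ᵥ* G), fun j hj => not_not.mp (Nat.find_min hex hj), ?_⟩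
  rw [dotProduct_smul, smul_eq_mul, inv_mul_cancel₀]
  exact fun h0 => Nat.find_spec hex (dotProduct_self_eq_zero.mp h0)

/-- The basis `h, Fᵀ h + a_1 h, …` of the observer canonical form. -/
noncomputable def outVec (F : Matrix (Fin m) (Fin m) ℝ) (h : Fin m → ℝ) : ℕ → Fin m → ℝ
  | 0 => h
  | i + 1 => outVec F h i ᵥ* F + charCoeff F (i + 1) • h

theorem outVec_eq_sum (F : Matrix (Fin m) (Fin m) ℝ) (h : Fin m → ℝ) (i : ℕ) :
    outVec F h i = ∑ l ∈ Finset.range (i + 1), charCoeff F l • (h ᵥ* F ^ (i - l)) := by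
  induction i with
  | zero =>
    have h1 : charCoeff F 0 = 1 := by
      have := (charpoly_monic F).coeff_natDegree
      rwa [charpoly_natDegree_eq_dim, Fintype.card_fin] at this
    simp [outVec, h1]
  | succ i ih =>
    rw [outVec, ih, Finset.sum_range_succ _ (i + 1), sum_vecMul]
    congr 1
    · refine Finset.sum_congr rfl fun l hl => ?_
      have : i + 1 - l = (i - l) + 1 := by
        have := Finset.mem_range.mp hl
        omega
      rw [smul_vecMul, vecMul_vecMul, this, pow_succ]
    · simp

/-- The sum is `h` times the characteristic polynomial evaluated at `F`, so Cayley–Hamilton ends the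
recursion. -/
theorem outVec_dim (F : Matrix (Fin m) (Fin m) ℝ) (h : Fin m → ℝ) : outVec F h m = 0 := by
  rw [outVec_eq_sum]
  have h1 : ∑ l ∈ Finset.range (m + 1), charCoeff F l • (h ᵥ* F ^ (m - l)) =
      ∑ l ∈ Finset.range (m + 1), F.charpoly.coeff l • (h ᵥ* F ^ l) := by
    rw [← Finset.sum_range_reflect]
    refine Finset.sum_congr rfl fun l hl => ?_
    have := Finset.mem_range.mp hl
    rw [charCoeff, show m - (m + 1 - 1 - l) = l by omega]
  have h2 := aeval_self_charpoly F
  rw [Polynomial.aeval_eq_sum_range, charpoly_natDegree_eq_dim, Fintype.card_fin] at h2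
  have h3 := congrArg (h ᵥ* ·) h2
  simp only [vecMul_sum, vecMul_smul, vecMul_zero] at h3
  rw [h1, h3]

theorem outVec_vecMul (F : Matrix (Fin m) (Fin m) ℝ) (h : Fin m → ℝ) (i : ℕ) :
    outVec F h i ᵥ* F = outVec F h (i + 1) + (-charCoeff F (i + 1)) • h := by
  rw [outVec, neg_smul, add_neg_cancel_right]

theorem Observable.eq_top_of_outVec_mem {F : Matrix (Fin m) (Fin m) ℝ} {h : Fin m → ℝ}
    (hobs : Observable F h) (p : Submodule ℝ (Fin m → ℝ)) (hp : ∀ i ≤ m, outVec F h i ∈ p) :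
    p = ⊤ := by
  have key : ∀ j i : ℕ, i ≤ m → outVec F h i ᵥ* F ^ j ∈ p := by
    intro j
    induction j with
    | zero => intro i hi; simpa using hp i hi
    | succ j ih =>
      intro i hi
      rcases hi.eq_or_lt with rfl | hlt
      · rw [outVec_dim, zero_vecMul]; exact p.zero_mem
      · rw [pow_succ', ← vecMul_vecMul, outVec_vecMul, add_vecMul, smul_vecMul]
        exact p.add_mem (ih _ hlt) (p.smul_mem _ (ih 0 (Nat.zero_le _)))
  exact hobs.eq_top_of_mem p fun j => key j 0 (Nat.zero_le _)

end LinearSystems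

/-! ### Invariant bounds on the shapes of the filter -/

section Shapes

variable {m mu : ℕ}

/-- Shape matrices whose widths along the observer basis are at most `M`. -/
structure BoundedShape (F : Matrix (Fin m) (Fin m) ℝ) (h : Fin m → ℝ) (M : ℕ → ℝ)
    (P : Matrix (Fin m) (Fin m) ℝ) : Prop extends PosForm P where
  width_le : ∀ i ≤ m, width P (outVec F h i) ≤ M i

/-- The directions along which the widths are uniformly bounded form a subspace, because widths are
seminorms; it contains the observer basis. -/
theorem BoundedShape.exists_width_le {F : Matrix (Fin m) (Fin m) ℝ} {h : Fin m → ℝ}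
    (hobs : Observable F h) (M : ℕ → ℝ) :
    ∃ K : ℝ, 0 ≤ K ∧ ∀ P, BoundedShape F h M P → ∀ i, width P (Pi.single i 1) ≤ K := by
  let p : Submodule ℝ (Fin m → ℝ) :=
    { carrier := {z | ∃ K : ℝ, ∀ P, BoundedShape F h M P → width P z ≤ K}
      zero_mem' := ⟨0, fun P _ => width_zero.le⟩
      add_mem' := fun {x y} ⟨K, hK⟩ ⟨K', hK'⟩ => ⟨K + K', fun P hP =>
        (hP.nonnegForm.width_add_le x y).trans (add_le_add (hK P hP) (hK' P hP))⟩
      smul_mem' := fun c x ⟨K, hK⟩ => ⟨|c| * K, fun P hP => by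
        rw [width_smul]; exact mul_le_mul_of_nonneg_left (hK P hP) (abs_nonneg c)⟩ }
  have htop : p = ⊤ := hobs.eq_top_of_outVec_mem p fun i hi => ⟨M i, fun P hP => hP.width_le i hi⟩
  have hall : ∀ z, ∃ K : ℝ, ∀ P, BoundedShape F h M P → width P z ≤ K := fun z => by
    have : z ∈ p := by rw [htop]; trivial
    exact this
  choose K hK using hall
  refine ⟨∑ i, |K (Pi.single i 1)|, Finset.sum_nonneg fun i _ => abs_nonneg _, fun P hP i => ?_⟩
  exact (hK _ P hP).trans ((le_abs_self _).trans
    (Finset.single_le_sum (f := fun i => |K (Pi.single i 1)|) (fun i _ => abs_nonneg _)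
      (Finset.mem_univ i)))

/-- The time update turns the width along `outVec i` into the width along `outVec i * F = outVec (i
+ 1) - a_{i+1} h`. The part along `h` has just been reset by the measurement, the other grew by at
most `θ`. No relation between the slab and the true state is needed. -/
theorem BoundedShape.update (hm : 1 ≤ m) {S : Plant m mu} (hh : S.h ≠ 0) (hW : 0 < S.W) {ε : ℝ}
    (hε : 0 < ε) {θ : ℝ} (hθ0 : 0 ≤ θ) (hθ : m ≠ 1 → √(gain m) ≤ θ) {M : ℕ → ℝ} {Δ C : ℝ}
    (hC : ∀ i < m, √(S.noiseGain ε) * width 1 (outVec S.F S.h i) ≤ C)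
    (hMm : 0 ≤ M m)
    (hM : ∀ i < m, √(1 + ε) * (|charCoeff S.F (i + 1)| * (√m * (Δ / 2)) + θ * M (i + 1)) + C ≤ M i)
    {E : Ellipsoid m} (hE : BoundedShape S.F S.h M E.shape) {lo hi : ℝ} (hle : lo ≤ hi)
    (hΔ : hi - lo = Δ) (u : Fin mu → ℝ) :
    BoundedShape S.F S.h M ((E.measUpdate S.h lo hi).timeUpdate S ε u).shape := by
  have hE' := Ellipsoid.measUpdate_nonnegForm hm hE.toPosForm hh hle
  refine ⟨Ellipsoid.timeUpdate_posForm hm hW hε u hE', fun i hi' => ?_⟩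
  rcases hi'.eq_or_lt with rfl | hlt
  · rw [outVec_dim, width_zero]; exact hMm
  refine (Ellipsoid.width_timeUpdate_le hε u hE' _).trans (le_trans ?_ (hM i hlt))
  refine add_le_add (mul_le_mul_of_nonneg_left ?_ (Real.sqrt_nonneg _)) (hC i hlt)
  rw [outVec_vecMul, add_comm]
  refine (hE'.width_add_le _ _).trans (add_le_add ?_ ?_)
  · rw [width_smul, abs_neg]
    refine mul_le_mul_of_nonneg_left ?_ (abs_nonneg _)
    rw [← hΔ]
    exact Ellipsoid.width_measUpdate_self_le hm hE.toPosForm hh hle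
  · by_cases hm1 : m = 1
    · have : i + 1 = m := by omega
      rw [this, outVec_dim, width_zero]
      positivity
    · refine (Ellipsoid.width_measUpdate_le hm hE.toPosForm hh hle _).trans ?_
      have h1 := hE.width_le (i + 1) hlt
      exact mul_le_mul (hθ hm1) h1 (width_nonneg _) hθ0

/-- Feasible widths: a quantizer range `L` and widths `M` that the filter does not exceed. -/
theorem exists_invariant_widths (m : ℕ) {N θ V : ℝ} (hN : 0 < N) (hθ : 0 ≤ θ) (hV : 0 ≤ V)
    {α : ℕ → ℝ} (hα : ∀ i, 0 ≤ α i)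
    (hB : √m * ∑ i ∈ Finset.range m, α i * θ ^ i < N) :
    ∃ ε : ℝ, 0 < ε ∧ ∀ C : ℝ, 0 ≤ C → ∃ (L : ℝ) (M : ℕ → ℝ), 0 < L ∧ M m = 0 ∧
      (∀ i < m, C ≤ M i) ∧
      (∀ i < m, √(1 + ε) * (α i * (√m * ((L / N + V) / 2)) + θ * M (i + 1)) + C ≤ M i) ∧
      M 0 + V / 2 ≤ L / 2 := by
  have hcont : Continuous fun l : ℝ => √m * ∑ i ∈ Finset.range m, l * α i * (l * θ) ^ i := by
    fun_prop
  -- Here `l` stands for `√(1 + ε)`; by continuity the strict rate inequality tolerates some `l >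
  -- 1`.
  have hev : ∀ᶠ l in nhdsWithin (1 : ℝ) (Set.Ioi 1),
      √m * ∑ i ∈ Finset.range m, l * α i * (l * θ) ^ i < N :=
    ((hcont.tendsto 1).mono_left nhdsWithin_le_nhds).eventually_lt_const (by simpa using hB)
  obtain ⟨l, hl, hl1⟩ := (hev.and self_mem_nhdsWithin).exists
  replace hl1 : 1 < l := hl1
  set B := √m * ∑ i ∈ Finset.range m, l * α i * (l * θ) ^ i with hBdef
  refine ⟨l ^ 2 - 1, by nlinarith, fun C hC => ?_⟩
  rw [show 1 + (l ^ 2 - 1) = l ^ 2 by ring, Real.sqrt_sq (by linarith)]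
  have hB0 : 0 ≤ B := mul_nonneg (Real.sqrt_nonneg _)
    (Finset.sum_nonneg fun i _ => by have := hα i; positivity)
  set C' := C * ∑ j ∈ Finset.range m, (l * θ) ^ j with hC'
  have hC'0 : 0 ≤ C' := mul_nonneg hC (Finset.sum_nonneg fun i _ => by positivity)
  have h1B : 0 < 1 - B / N := by rw [sub_pos, div_lt_one hN]; exact hl
  -- The final inequality reads `L (1 - B / N) ≥ V B + 2 C' + V`; the extra `1` makes `L` positive.
  set L := (V * B + 2 * C' + V + 1) / (1 - B / N) with hL
  have hLeq : L * (1 - B / N) = V * B + 2 * C' + V + 1 := div_mul_cancel₀ _ h1B.ne'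
  have hLpos : 0 < L := by positivity
  set D := √m * ((L / N + V) / 2) with hD
  have hD0 : 0 ≤ D := by positivity
  have hterm : ∀ i j : ℕ, 0 ≤ (l * θ) ^ j * (l * α (i + j) * D + C) := fun i j => by
    have := hα (i + j); positivity
  have hrec : ∀ i < m, ∑ j ∈ Finset.range (m - i), (l * θ) ^ j * (l * α (i + j) * D + C) =
      l * (α i * D + θ * ∑ j ∈ Finset.range (m - (i + 1)),
        (l * θ) ^ j * (l * α (i + 1 + j) * D + C)) + C := fun i hi => by
    have h1 : ∑ j ∈ Finset.range (m - (i + 1)), (l * θ) ^ (j + 1) * (l * α (i + (j + 1)) * D + C) =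
        l * θ * ∑ j ∈ Finset.range (m - (i + 1)), (l * θ) ^ j * (l * α (i + 1 + j) * D + C) := by
      rw [Finset.mul_sum]
      refine Finset.sum_congr rfl fun j _ => ?_
      rw [pow_succ, show i + (j + 1) = i + 1 + j by omega]; ring
    rw [show m - i = m - (i + 1) + 1 by omega, Finset.sum_range_succ', h1, pow_zero, add_zero]
    ring
  -- These `M i` are the recursion unrolled, with equality, from `M m = 0`.
  refine ⟨L, fun i => ∑ j ∈ Finset.range (m - i), (l * θ) ^ j * (l * α (i + j) * D + C),
    hLpos, by simp, fun i hi => ?_, fun i hi => (hrec i hi).ge, ?_⟩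
  · change C ≤ ∑ j ∈ Finset.range (m - i), (l * θ) ^ j * (l * α (i + j) * D + C)
    rw [hrec i hi]
    have h1 := hα i
    have h2 : 0 ≤ ∑ j ∈ Finset.range (m - (i + 1)), (l * θ) ^ j * (l * α (i + 1 + j) * D + C) :=
      Finset.sum_nonneg fun j _ => hterm _ _
    have : 0 ≤ l * (α i * D + θ * ∑ j ∈ Finset.range (m - (i + 1)),
        (l * θ) ^ j * (l * α (i + 1 + j) * D + C)) := by positivity
    linarith
  · have h0 : ∑ j ∈ Finset.range (m - 0), (l * θ) ^ j * (l * α (0 + j) * D + C) =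
        (L / N + V) / 2 * B + C' := by
      rw [hBdef, hC', hD, Nat.sub_zero, Finset.mul_sum, Finset.mul_sum, Finset.mul_sum,
        ← Finset.sum_add_distrib]
      refine Finset.sum_congr rfl fun j _ => ?_
      rw [zero_add]; ring
    simp only [h0]
    have : L * (1 - B / N) = L - L / N * B := by ring
    linarith

end Shapes

/-! ### The strategy -/

section Strategy

variable {m mu k : ℕ}

/-- A numbering of the binary words. -/
noncomputable def wordEquiv (k : ℕ) : Word k ≃ Fin (2 ^ k) :=
  Fintype.equivFinOfCardEq (by simp)

/-- A finite sequence, continued by zero. -/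
def zeroExtend {α : Type*} [Zero α] {n : ℕ} (f : Fin n → α) (s : ℕ) : α :=
  if hs : s < n then f ⟨s, hs⟩ else 0

theorem zeroExtend_of_lt {α : Type*} [Zero α] {n s : ℕ} (f : ℕ → α) (hs : s < n) :
    zeroExtend (fun i : Fin n => f i) s = f s := by
  simp [zeroExtend, hs]

/-- The part of the state that is due to the inputs. -/
noncomputable def Plant.reach (S : Plant m mu) (u : ℕ → Fin mu → ℝ) : ℕ → Fin m → ℝ
  | 0 => 0
  | s + 1 => S.F *ᵥ S.reach u s + S.G *ᵥ u s

/-- The part of the state that is not due to the inputs. -/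
noncomputable def Plant.free (S : Plant m mu) (x₀ : Fin m → ℝ) (w : ℕ → Fin m → ℝ) :
    ℕ → Fin m → ℝ
  | 0 => x₀
  | s + 1 => S.F *ᵥ S.free x₀ w s + w s

theorem Plant.reach_congr (S : Plant m mu) {u u' : ℕ → Fin mu → ℝ} {t : ℕ}
    (h : ∀ s < t, u s = u' s) : S.reach u t = S.reach u' t := by
  induction t with
  | zero => rfl
  | succ t ih => rw [reach, reach, ih fun s hs => h s (by omega), h t (by omega)]

/-- The free parameters of observer and controller: the range `L` of the quantizer, the parameter
`ε` of the filter, a right inverse `R` of the controllability matrix, and an input direction `q`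
that reaches the output after `r + 1` steps. -/
structure Design (m mu : ℕ) where
  L : ℝ
  ε : ℝ
  R : Matrix (Fin m × Fin mu) (Fin m) ℝ
  q : Fin mu → ℝ
  r : ℕ

/-- The lower end of the quantization cell with number `j`, relative to the predicted output. -/
noncomputable def Design.cellEnd (D : Design m mu) (k j : ℕ) : ℝ :=
  D.L * ((j : ℝ) / 2 ^ k - 1 / 2)

/-- The interval assigned to a message: one of `2 ^ k` equal parts of an interval of length `L`
around the predicted output. -/
noncomputable def Design.cell (D : Design m mu) (S : Plant m mu) (E : Ellipsoid m) (b : Word k) :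
    ℝ × ℝ :=
  (S.h ⬝ᵥ E.center + D.cellEnd k (wordEquiv k b), S.h ⬝ᵥ E.center + D.cellEnd k (wordEquiv k b + 1))

theorem floor_mul_fract_lt (k : ℕ) (r : ℝ) : ⌊2 ^ k * Int.fract r⌋₊ < 2 ^ k := by
  rw [Nat.floor_lt (mul_nonneg (by positivity) (Int.fract_nonneg r))]
  push_cast
  exact mul_lt_of_lt_one_right (by positivity) (Int.fract_lt_one r)

/-- The word whose cell contains the number with fractional part `Int.fract r`. -/
noncomputable def wordOf (k : ℕ) (r : ℝ) : Word k :=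
  (wordEquiv k).symm ⟨⌊2 ^ k * Int.fract r⌋₊, floor_mul_fract_lt k r⟩

/-- The message for the measurement `y` if the filter predicts `E`. -/
noncomputable def Design.quantize (D : Design m mu) (k : ℕ) (S : Plant m mu) (E : Ellipsoid m)
    (y : ℝ) : Word k :=
  wordOf k ((y - S.h ⬝ᵥ E.center) / D.L + 1 / 2)

/-- One step of the filter. -/
noncomputable def Design.step (D : Design m mu) (S : Plant m mu) (E : Ellipsoid m) (b : Word k)
    (u : Fin mu → ℝ) : Ellipsoid m :=
  (E.measUpdate S.h ((D.cell S E b).1 - S.V / 2) ((D.cell S E b).2 + S.V / 2)).timeUpdate S D.ε u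

/-- The observer's copy of the filter, which ignores the inputs. -/
noncomputable def Design.track (D : Design m mu) (k : ℕ) (S : Plant m mu) (y : ℕ → ℝ) :
    ℕ → Ellipsoid m
  | 0 => ⟨S.P₀, 0⟩
  | s + 1 => D.step S (D.track k S y s) (D.quantize k S (D.track k S y s) (y s)) 0

/-- The observer's message. -/
noncomputable def Design.message (D : Design m mu) (k : ℕ) (S : Plant m mu) (y : ℕ → ℝ)
    (t : ℕ) : Word k :=
  D.quantize k S (D.track k S y t) (y t)

/-- The input of the deadbeat controller at time `s` for the estimate at the beginning of
the current block of `m` steps. -/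
noncomputable def Design.nominal (D : Design m mu) (S : Plant m mu) (s : ℕ) (xhat : Fin m → ℝ) :
    Fin mu → ℝ :=
  -- The order is reversed because the input at offset `i` of a block is multiplied by `F^(m-1-i)`
  -- by the end of the block.
  if hs : s % m < m then fun a => -(D.R *ᵥ (S.F ^ m *ᵥ xhat)) (Fin.rev ⟨s % m, hs⟩, a) else 0

/-- The output that the nominal input would cause `r + 1` steps later, as far as it is due to
inputs. -/
noncomputable def Design.lookahead (D : Design m mu) (S : Plant m mu) (U : Fin mu → ℝ)
    (X : Fin m → ℝ) : ℝ :=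
  (S.h ᵥ* S.F ^ (D.r + 1)) ⬝ᵥ X + ((S.h ᵥ* S.F ^ D.r) ᵥ* S.G) ⬝ᵥ U

/-- The nominal input, changed such that the outputs due to inputs are multiples of `L`. -/
noncomputable def Design.adjust (D : Design m mu) (S : Plant m mu) (U : Fin mu → ℝ)
    (X : Fin m → ℝ) : Fin mu → ℝ :=
  U - (D.L * Int.fract (D.lookahead S U X / D.L)) • D.q

/-- The estimate of the state at the beginning of the current block of `m` steps. -/
def blockEstimate (m : ℕ) (est : ℕ → Fin m → ℝ) (s : ℕ) : Fin m → ℝ :=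
  -- The estimate with index `t` concerns `x_{t+1}`, hence the shift by one; at time `0` there is no
  -- estimate yet.
  if m * (s / m) = 0 then 0 else est (m * (s / m) - 1)

/-! ### Causality and measurability of the messages. -/

theorem measurable_wordOf (k : ℕ) : Measurable (wordOf k) := by
  have h1 : Measurable fun r : ℝ => ⌊2 ^ k * Int.fract r⌋₊ :=
    Nat.measurable_floor.comp (measurable_fract.const_mul _)
  have h2 : wordOf k = (fun j : ℕ => if hj : j < 2 ^ k then (wordEquiv k).symm ⟨j, hj⟩
      else fun _ => false) ∘ fun r : ℝ => ⌊2 ^ k * Int.fract r⌋₊ :=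
    funext fun r => by simp only [wordOf, Function.comp, dif_pos (floor_mul_fract_lt k r)]
  rw [h2]
  exact (measurable_of_countable _).comp h1

theorem Design.track_congr (D : Design m mu) (S : Plant m mu) {y y' : ℕ → ℝ} {t : ℕ}
    (h : ∀ s < t, D.message k S y s = D.message k S y' s) :
    D.track k S y t = D.track k S y' t := by
  induction t with
  | zero => rfl
  | succ t ih =>
    have h1 := h t (by omega)
    unfold message at h1
    rw [track, h1, ih fun s hs => h s (by omega), track]

theorem Design.message_congr (D : Design m mu) (S : Plant m mu) {y y' : ℕ → ℝ} {t : ℕ}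
    (h : ∀ s ≤ t, y s = y' s) : D.message k S y t = D.message k S y' t := by
  induction t using Nat.strong_induction_on with
  | _ t ih =>
    rw [message, D.track_congr S fun s hs => ih s hs fun s' hs' => h s' (by omega), h t le_rfl,
      message]

theorem Design.measurable_message (D : Design m mu) (S : Plant m mu) (t : ℕ) :
    Measurable fun y : ℕ → ℝ => D.message k S y t := by
  induction t using Nat.strong_induction_on with
  | _ t ih =>
    have h1 : Measurable fun (y : ℕ → ℝ) (s : Fin t) => D.message k S y s :=
      measurable_pi_lambda _ fun s => ih s s.2
    -- The tracked centre depends on `y` only through finitely many earlier words. It is thus a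
    -- function on a finite type, and the measurability of the filter formulas is never needed.
    obtain ⟨g, hg⟩ : ∃ g : (Fin t → Word k) → ℝ, ∀ y : ℕ → ℝ,
        S.h ⬝ᵥ (D.track k S y t).center = g fun s : Fin t => D.message k S y s := by
      have : Function.FactorsThrough (fun y : ℕ → ℝ => S.h ⬝ᵥ (D.track k S y t).center)
          (fun (y : ℕ → ℝ) (s : Fin t) => D.message k S y s) := fun y y' hyy => by
        simp only
        rw [D.track_congr S fun s hs => congrFun hyy ⟨s, hs⟩]
      refine ⟨Function.extend (fun (y : ℕ → ℝ) (s : Fin t) => D.message k S y s)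
        (fun y : ℕ → ℝ => S.h ⬝ᵥ (D.track k S y t).center) 0, fun y => (this.extend_apply 0 y).symm⟩
    have h2 : Measurable fun y : ℕ → ℝ => (y t - S.h ⬝ᵥ (D.track k S y t).center) / D.L + 1 / 2 := by
      simp only [hg]
      exact (((measurable_pi_apply t).sub ((measurable_of_finite g).comp h1)).div_const _).add_const _
    exact (measurable_wordOf k).comp h2

/-- The strategy: the observer sends the position of `y_t` modulo `L` relative to its own filter,
the controller applies a deadbeat control in blocks of `m` steps, adjusted such that the outputs
due to inputs are multiples of `L`. -/
noncomputable def Design.strategy (D : Design m mu) (k : ℕ) (S : Plant m mu) (hε : 0 < D.ε) :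
    Strategy m mu k where
  obs t y := D.message k S (zeroExtend y) t
  measurable_obs t := by
    refine (D.measurable_message S t).comp (measurable_pi_lambda _ fun s => ?_)
    unfold zeroExtend
    split_ifs with h
    · exact measurable_pi_apply _
    · exact measurable_const
  cell := D.cell S
  ε := D.ε
  ε_pos := hε
  law t est inp :=
    D.adjust S (D.nominal S (t + 1) (blockEstimate m (zeroExtend est) (t + 1)))
      (S.reach (zeroExtend inp) (t + 1))

theorem Design.predict_succ (D : Design m mu) (S : Plant m mu) (hε : 0 < D.ε) (b : ℕ → Word k)
    (u : ℕ → Fin mu → ℝ) (s : ℕ) :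
    (D.strategy k S hε).predict S b u (s + 1) =
      D.step S ((D.strategy k S hε).predict S b u s) (b s) (u s) := rfl

theorem Strategy.predict_congr (σ : Strategy m mu k) (S : Plant m mu) {b b' : ℕ → Word k}
    (u : ℕ → Fin mu → ℝ) {t : ℕ} (h : ∀ s < t, b s = b' s) :
    σ.predict S b u t = σ.predict S b' u t := by
  induction t with
  | zero => rfl
  | succ t ih => simp only [predict, ih fun s hs => h s (by omega), h t (by omega)]

/-! ### Translation invariance of the filter and periodicity of the quantizer. -/

/-- Translation of an ellipsoid. -/
def Ellipsoid.shift (E : Ellipsoid m) (X : Fin m → ℝ) : Ellipsoid m := ⟨E.shape, E.center + X⟩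

/-- Cells are placed relative to the predicted output, so the centre cancels and only the shape and
the word matter. -/
theorem Design.slab_cell (D : Design m mu) (S : Plant m mu) (E : Ellipsoid m) (b : Word k) :
    E.slab S.h ((D.cell S E b).1 - S.V / 2) ((D.cell S E b).2 + S.V / 2) =
      slabParams m (clip ((D.cellEnd k (wordEquiv k b) - S.V / 2) / √(quad E.shape S.h)))
        (clip ((D.cellEnd k (wordEquiv k b + 1) + S.V / 2) / √(quad E.shape S.h))) := by
  rw [Ellipsoid.slab, cell]
  congr 3 <;> ring

theorem Design.step_shift (D : Design m mu) (S : Plant m mu) (E : Ellipsoid m) (X : Fin m → ℝ)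
    (b : Word k) (u : Fin mu → ℝ) :
    D.step S (E.shift X) b u = (D.step S E b 0).shift (S.F *ᵥ X + S.G *ᵥ u) := by
  have h1 : (E.shift X).slab S.h ((D.cell S (E.shift X) b).1 - S.V / 2)
      ((D.cell S (E.shift X) b).2 + S.V / 2) =
      E.slab S.h ((D.cell S E b).1 - S.V / 2) ((D.cell S E b).2 + S.V / 2) := by
    rw [slab_cell, slab_cell]; rfl
  have h2 : ((E.shift X).measUpdate S.h ((D.cell S (E.shift X) b).1 - S.V / 2)
      ((D.cell S (E.shift X) b).2 + S.V / 2)).shape =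
      (E.measUpdate S.h ((D.cell S E b).1 - S.V / 2) ((D.cell S E b).2 + S.V / 2)).shape := by
    rw [Ellipsoid.measUpdate_shape, Ellipsoid.measUpdate_shape, h1]; rfl
  have h3 : ((E.shift X).measUpdate S.h ((D.cell S (E.shift X) b).1 - S.V / 2)
      ((D.cell S (E.shift X) b).2 + S.V / 2)).center =
      (E.measUpdate S.h ((D.cell S E b).1 - S.V / 2) ((D.cell S E b).2 + S.V / 2)).center + X := by
    rw [Ellipsoid.measUpdate_center, Ellipsoid.measUpdate_center, h1]
    simp only [Ellipsoid.shift]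
    abel
  rw [step, step, Ellipsoid.timeUpdate, Ellipsoid.timeUpdate, h2, h3, Ellipsoid.shift,
    Ellipsoid.mk.injEq]
  refine ⟨rfl, ?_⟩
  simp only [mulVec_add, mulVec_zero, add_zero]
  abel

/-- The filter with correct messages is a translate of the observer's copy. -/
theorem Design.predict_message (D : Design m mu) (S : Plant m mu) (hε : 0 < D.ε) (y : ℕ → ℝ)
    (u : ℕ → Fin mu → ℝ) (t : ℕ) :
    (D.strategy k S hε).predict S (D.message k S y) u t =
      (D.track k S y t).shift (S.reach u t) := by
  induction t with
  | zero => simp [Strategy.predict, track, Ellipsoid.shift, Plant.reach]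
  | succ t ih => rw [predict_succ, ih, step_shift, track, ← message, Plant.reach]

theorem wordOf_add_int (k : ℕ) (r : ℝ) (z : ℤ) : wordOf k (r + z) = wordOf k r := by
  unfold wordOf
  simp only [Int.fract_add_intCast]

theorem Design.quantize_add_mul (D : Design m mu) (S : Plant m mu) (hL : D.L ≠ 0)
    (E : Ellipsoid m) (y : ℝ) (z : ℤ) :
    D.quantize k S E (y + D.L * z) = D.quantize k S E y := by
  have : (y + D.L * z - S.h ⬝ᵥ E.center) / D.L + 1 / 2 =
      (y - S.h ⬝ᵥ E.center) / D.L + 1 / 2 + z := by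
    field_simp
    ring
  rw [quantize, this, wordOf_add_int, quantize]

/-- The observer only uses the measurements modulo `L`. -/
theorem Design.message_add_mul (D : Design m mu) (S : Plant m mu) (hL : D.L ≠ 0) (y : ℕ → ℝ)
    (z : ℕ → ℤ) (t : ℕ) :
    D.message k S (fun s => y s + D.L * z s) t = D.message k S y t := by
  induction t using Nat.strong_induction_on with
  | _ t ih => rw [message, D.quantize_add_mul S hL, D.track_congr S ih, message]

theorem Design.quantize_shift (D : Design m mu) (S : Plant m mu) (hL : D.L ≠ 0)
    (E : Ellipsoid m) {X : Fin m → ℝ} {z : ℤ} (hX : S.h ⬝ᵥ X = D.L * z) (y : ℝ) :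
    D.quantize k S (E.shift X) y = D.quantize k S E y := by
  rw [← D.quantize_add_mul S hL _ _ z, quantize, quantize, Ellipsoid.shift]
  simp only [dotProduct_add, hX]
  congr 3
  ring

/-- The cell of the message contains the measurement if that is less than `L / 2` away from the
predicted one. -/
theorem Design.mem_cell (D : Design m mu) (S : Plant m mu) (hL : 0 < D.L) (E : Ellipsoid m)
    {y : ℝ} (hy : |y - S.h ⬝ᵥ E.center| < D.L / 2) :
    (D.cell S E (D.quantize k S E y)).1 ≤ y ∧ y ≤ (D.cell S E (D.quantize k S E y)).2 := by
  obtain ⟨h1, h2⟩ := abs_lt.mp hy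
  set ρ := (y - S.h ⬝ᵥ E.center) / D.L + 1 / 2 with hρ
  have hyρ : y = S.h ⬝ᵥ E.center + D.L * (ρ - 1 / 2) := by rw [hρ]; field_simp; ring
  have h0 : 0 ≤ ρ := by
    have : -(1 / 2) ≤ (y - S.h ⬝ᵥ E.center) / D.L := by rw [le_div_iff₀ hL]; linarith
    linarith
  have h1 : ρ < 1 := by
    have : (y - S.h ⬝ᵥ E.center) / D.L < 1 / 2 := by rw [div_lt_iff₀ hL]; linarith
    linarith
  have hfr : Int.fract ρ = ρ := Int.fract_eq_self.mpr ⟨h0, h1⟩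
  have hw : ((wordEquiv k (D.quantize k S E y) : Fin (2 ^ k)) : ℕ) = ⌊2 ^ k * ρ⌋₊ := by
    rw [quantize, wordOf, Equiv.apply_symm_apply]
    simp only [← hρ, hfr]
  have h2k : (0 : ℝ) < 2 ^ k := by positivity
  have hle := Nat.floor_le (show 0 ≤ 2 ^ k * ρ by positivity)
  have hlt := Nat.lt_floor_add_one (2 ^ k * ρ)
  rw [cell, hw, cellEnd, cellEnd]
  have h3 : (⌊2 ^ k * ρ⌋₊ : ℝ) / 2 ^ k ≤ ρ := by rw [div_le_iff₀ h2k]; linarith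
  have h4 : ρ ≤ ((⌊2 ^ k * ρ⌋₊ + 1 : ℕ) : ℝ) / 2 ^ k := by
    rw [le_div_iff₀ h2k]; push_cast; linarith
  have h5 := mul_le_mul_of_nonneg_left h3 hL.le
  have h6 := mul_le_mul_of_nonneg_left h4 hL.le
  constructor <;> linarith

end Strategy

/-! ### Growth of linear recursions -/

section Growth

variable {m : ℕ}

theorem exists_norm_mulVec_le {ι κ : Type*} [Fintype ι] [Fintype κ] (A : Matrix ι κ ℝ) :
    ∃ C : ℝ, 0 ≤ C ∧ ∀ z, ‖A *ᵥ z‖ ≤ C * ‖z‖ :=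
  ⟨‖LinearMap.toContinuousLinearMap A.mulVecLin‖, norm_nonneg _, fun z =>
    (LinearMap.toContinuousLinearMap A.mulVecLin).le_opNorm z⟩

theorem linear_recursion {F : Matrix (Fin m) (Fin m) ℝ} {e f : ℕ → Fin m → ℝ}
    (h : ∀ s, e (s + 1) = F *ᵥ e s + f s) (τ d : ℕ) :
    e (τ + d) = F ^ d *ᵥ e τ + ∑ i ∈ Finset.range d, F ^ (d - 1 - i) *ᵥ f (τ + i) := by
  induction d with
  | zero => simp
  | succ d ih =>
    rw [← add_assoc, h, ih, mulVec_add, mulVec_mulVec, ← pow_succ', Finset.sum_range_succ,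
      mulVec_sum, add_assoc]
    simp only [add_tsub_cancel_right, tsub_self, pow_zero, one_mulVec]
    congr 2
    refine Finset.sum_congr rfl fun i hi => ?_
    have := Finset.mem_range.mp hi
    rw [mulVec_mulVec, ← pow_succ', show d - 1 - i + 1 = d - i by omega]

theorem norm_linear_recursion_le {F : Matrix (Fin m) (Fin m) ℝ} {C ρ : ℝ} (hC : 0 ≤ C)
    (hρ : 1 < ρ) (hF : ∀ (j : ℕ) z, ‖F ^ j *ᵥ z‖ ≤ C * ρ ^ j * ‖z‖) {e f : ℕ → Fin m → ℝ}
    (h : ∀ s, e (s + 1) = F *ᵥ e s + f s) {K : ℝ} (hf : ∀ s, ‖f s‖ ≤ K) (τ d : ℕ) :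
    ‖e (τ + d)‖ ≤ C * (‖e τ‖ + K / (ρ - 1)) * ρ ^ d := by
  have hK : 0 ≤ K := (norm_nonneg _).trans (hf 0)
  have hρ1 : 0 < ρ - 1 := by linarith
  rw [linear_recursion h]
  have h1 : ‖∑ i ∈ Finset.range d, F ^ (d - 1 - i) *ᵥ f (τ + i)‖ ≤
      ∑ i ∈ Finset.range d, C * ρ ^ (d - 1 - i) * K :=
    norm_sum_le_of_le _ fun i _ => (hF _ _).trans (by gcongr; exact hf _)
  have h2 : ∑ i ∈ Finset.range d, C * ρ ^ (d - 1 - i) * K = C * K * ((ρ ^ d - 1) / (ρ - 1)) := by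
    rw [← geom_sum_eq hρ.ne', Finset.mul_sum,
      ← Finset.sum_range_reflect (fun i => C * K * ρ ^ i)]
    exact Finset.sum_congr rfl fun i _ => by ring
  have h3 : (ρ ^ d - 1) / (ρ - 1) ≤ ρ ^ d / (ρ - 1) := by gcongr; linarith
  calc _ ≤ C * ρ ^ d * ‖e τ‖ + C * K * (ρ ^ d / (ρ - 1)) :=
        (norm_add_le _ _).trans (add_le_add (hF d _) (h1.trans (h2.le.trans (by gcongr))))
    _ = C * (‖e τ‖ + K / (ρ - 1)) * ρ ^ d := by ring

theorem norm_le_of_abs_single_le {z : Fin m → ℝ} {K : ℝ} (hK : 0 ≤ K)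
    (h : ∀ i, |Pi.single i 1 ⬝ᵥ z| ≤ K) : ‖z‖ ≤ K := by
  rw [pi_norm_le_iff_of_nonneg hK]
  intro i
  have := h i
  rwa [single_one_dotProduct] at this

end Growth

/-! ### The closed loop -/

section ClosedLoop

variable {m mu k n : ℕ} {Z Ξ : Type*} [MeasurableSpace Z] [MeasurableSpace Ξ]

/-- The requirements on the parameters of the strategy; `M` bounds the widths of the ellipsoids
of the filter along the observer basis. -/
structure Design.Valid (D : Design m mu) (k : ℕ) (S : Plant m mu) (M : ℕ → ℝ) : Prop where
  dim_pos : 1 ≤ m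
  h_ne : S.h ≠ 0
  V_pos : 0 < S.V
  L_pos : 0 < D.L
  ε_pos : 0 < D.ε
  delay : ∀ j < D.r, (S.h ᵥ* S.F ^ j) ᵥ* S.G = 0
  unit_gain : ((S.h ᵥ* S.F ^ D.r) ᵥ* S.G) ⬝ᵥ D.q = 1
  right_inverse : ctrlMatrix S.F S.G * D.R = 1
  range_le : M 0 + S.V / 2 ≤ D.L / 2
  init : BoundedShape S.F S.h M S.P₀
  update : ∀ (E : Ellipsoid m) (lo hi : ℝ) (u : Fin mu → ℝ), BoundedShape S.F S.h M E.shape →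
    hi - lo = D.L / 2 ^ k + S.V → BoundedShape S.F S.h M
      ((E.measUpdate S.h lo hi).timeUpdate S D.ε u).shape

variable {D : Design m mu} {S : Plant m mu} {M : ℕ → ℝ} {hε : 0 < D.ε}
  {code : Code n k Z} {ch : Channel n Z Ξ} {x₀ : Fin m → ℝ} {w : ℕ → Fin m → ℝ} {v : ℕ → ℝ}
  {ξ : Ξ} {x : ℕ → Fin m → ℝ} {u : ℕ → Fin mu → ℝ} {y : ℕ → ℝ} {b : ℕ → Word k}

theorem Design.cell_sub (D : Design m mu) (S : Plant m mu) (E : Ellipsoid m) (b : Word k) :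
    ((D.cell S E b).2 + S.V / 2) - ((D.cell S E b).1 - S.V / 2) = D.L / 2 ^ k + S.V := by
  rw [cell, cellEnd, cellEnd]
  push_cast
  ring

/-- This holds for arbitrary messages, right or wrong, because all cells have the same length. It is
what controls the filter after decoding errors. -/
theorem Design.Valid.predict (hD : D.Valid k S M) (b : ℕ → Word k) (u : ℕ → Fin mu → ℝ) (t : ℕ) :
    BoundedShape S.F S.h M ((D.strategy k S hε).predict S b u t).shape := by
  induction t with
  | zero => exact hD.init
  | succ t ih => exact hD.update _ _ _ _ ih (D.cell_sub S _ _)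

/-- By the unit gain of `q`, the correction subtracts exactly the remainder modulo `L`. -/
theorem Design.lookahead_adjust (hD : D.Valid k S M) (U : Fin mu → ℝ) (X : Fin m → ℝ) :
    D.lookahead S (D.adjust S U X) X = D.L * ⌊D.lookahead S U X / D.L⌋ := by
  have h1 : D.lookahead S (D.adjust S U X) X =
      D.lookahead S U X - D.L * Int.fract (D.lookahead S U X / D.L) := by
    conv_lhs => rw [lookahead, adjust, dotProduct_sub, dotProduct_smul, hD.unit_gain]
    rw [smul_eq_mul, mul_one, lookahead]
    ring
  have hL := hD.L_pos.ne'
  have h2 := Int.self_sub_fract (D.lookahead S U X / D.L)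
  rw [h1, ← h2, mul_sub, mul_div_cancel₀ _ hL]

/-- The inputs applied in between do not reach these outputs, as the first `r` Markov parameters
vanish. -/
theorem Plant.output_reach_add (S : Plant m mu) {r : ℕ}
    (hr : ∀ j < r, (S.h ᵥ* S.F ^ j) ᵥ* S.G = 0) (u : ℕ → Fin mu → ℝ) (s j : ℕ) (hj : j ≤ r) :
    (S.h ᵥ* S.F ^ j) ⬝ᵥ S.reach u s = S.h ⬝ᵥ S.reach u (s + j) := by
  induction j generalizing s with
  | zero => simp
  | succ j ih =>
    rw [show s + (j + 1) = s + 1 + j by omega, ← ih (s + 1) (by omega), reach, dotProduct_add,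
      dotProduct_mulVec, dotProduct_mulVec, hr j hj, zero_dotProduct, add_zero, vecMul_vecMul,
      ← pow_succ]

/-- The estimates of the current state: `0` at time `0`, `x̂_{s|s-1}` at time `s ≥ 1`. -/
noncomputable def stateEstimate (σ : Strategy m mu k) (S : Plant m mu) (code : Code n k Z)
    (ch : Channel n Z Ξ) (b : ℕ → Word k) (u : ℕ → Fin mu → ℝ) (ξ : Ξ) (s : ℕ) : Fin m → ℝ :=
  if s = 0 then 0 else (σ.estimate S code ch b u ξ (s - 1)).center

theorem IsClosedLoop.input_succ (cl : IsClosedLoop S (D.strategy k S hε) code ch x₀ w v ξ x u y b)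
    (t : ℕ) : u (t + 1) = D.adjust S (D.nominal S (t + 1)
      (stateEstimate (D.strategy k S hε) S code ch b u ξ (m * ((t + 1) / m))))
      (S.reach u (t + 1)) := by
  rw [cl.u_succ t]
  change D.adjust S (D.nominal S (t + 1) (blockEstimate m (zeroExtend _) (t + 1)))
      (S.reach (zeroExtend _) (t + 1)) = _
  rw [S.reach_congr (u' := u) fun s hs => zeroExtend_of_lt u hs]
  congr 2
  unfold blockEstimate stateEstimate
  split_ifs with h
  · rfl
  · have := Nat.mul_div_le (t + 1) m
    exact zeroExtend_of_lt
      (fun s => ((D.strategy k S hε).estimate S code ch b u ξ s).center) (by omega)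

/-- Up to time `r` no input has reached the output. Later, the part due to inputs is the lookahead
value of `r + 1` steps before, which `adjust` made a multiple of `L`. -/
theorem IsClosedLoop.output_reach (cl : IsClosedLoop S (D.strategy k S hε) code ch x₀ w v ξ x u y b)
    (hD : D.Valid k S M) (t : ℕ) : ∃ z : ℤ, S.h ⬝ᵥ S.reach u t = D.L * z := by
  rcases le_or_gt t D.r with ht | ht
  · refine ⟨0, ?_⟩
    have := S.output_reach_add hD.delay u 0 t ht
    rw [zero_add] at this
    rw [← this, Plant.reach]
    simp
  · obtain ⟨s, rfl⟩ : ∃ s, t = s + 1 + D.r := ⟨t - (D.r + 1), by omega⟩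
    have h1 : S.h ⬝ᵥ S.reach u (s + 1 + D.r) = D.lookahead S (u s) (S.reach u s) := by
      rw [← S.output_reach_add hD.delay u (s + 1) D.r le_rfl, Plant.reach, dotProduct_add,
        dotProduct_mulVec, dotProduct_mulVec, vecMul_vecMul, ← pow_succ, Design.lookahead]
    rw [h1]
    cases s with
    -- The first input is prescribed to be zero and is not adjusted, but its lookahead value is zero
    -- anyway.
    | zero => exact ⟨0, by simp [Design.lookahead, Plant.reach, cl.u_zero]⟩
    | succ s =>
      rw [cl.input_succ s, Design.lookahead_adjust hD]
      exact ⟨_, rfl⟩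

theorem IsClosedLoop.state_eq (cl : IsClosedLoop S (D.strategy k S hε) code ch x₀ w v ξ x u y b)
    (t : ℕ) : x t = S.free x₀ w t + S.reach u t := by
  induction t with
  | zero => rw [cl.x_zero, Plant.free, Plant.reach, add_zero]
  | succ t ih =>
    rw [cl.x_succ, ih, Plant.free, Plant.reach, mulVec_add]
    abel

theorem IsClosedLoop.message_eq (cl : IsClosedLoop S (D.strategy k S hε) code ch x₀ w v ξ x u y b) :
    b = D.message k S y := by
  ext1 t
  rw [cl.b_eq t]
  exact D.message_congr S fun s hs => zeroExtend_of_lt y (by omega)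

/-- The messages do not depend on the inputs. -/
theorem IsClosedLoop.message_eq_free
    (cl : IsClosedLoop S (D.strategy k S hε) code ch x₀ w v ξ x u y b) (hD : D.Valid k S M) :
    b = D.message k S fun t => S.h ⬝ᵥ S.free x₀ w t + v t := by
  choose z hz using cl.output_reach hD
  have hy : y = fun t => (S.h ⬝ᵥ S.free x₀ w t + v t) + D.L * z t := by
    ext1 t
    rw [cl.y_eq, cl.state_eq, dotProduct_add, hz]
    ring
  ext1 t
  rw [cl.message_eq, hy]
  exact D.message_add_mul S hD.L_pos.ne' _ z t

theorem IsClosedLoop.predict_encloses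
    (cl : IsClosedLoop S (D.strategy k S hε) code ch x₀ w v ξ x u y b) (hD : D.Valid k S M)
    (hx₀ : x₀ ∈ (Ellipsoid.mk S.P₀ 0).carrier) (hw : ∀ t, ‖w t‖ < S.W / 2)
    (hv : ∀ t, |v t| < S.V / 2) (t : ℕ) :
    ((D.strategy k S hε).predict S b u t).Encloses (x t) := by
  induction t with
  | zero =>
    rw [cl.x_zero]
    exact (Ellipsoid.mem_carrier_iff hD.init.toPosForm x₀).mp hx₀
  | succ t ih =>
    have hP : BoundedShape S.F S.h M ((D.strategy k S hε).predict S b u t).shape :=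
      hD.predict b u t
    rw [cl.x_succ, Design.predict_succ]
    refine Ellipsoid.Encloses.timeUpdate hD.ε_pos ?_ (hw t).le
    obtain ⟨z, hz⟩ := cl.output_reach hD t
    have hb : b t = D.quantize k S ((D.strategy k S hε).predict S b u t) (y t) := by
      conv_rhs => rw [cl.message_eq]
      rw [D.predict_message, D.quantize_shift S hD.L_pos.ne' _ hz, ← Design.message,
        ← cl.message_eq]
    rw [hb]
    set E := (D.strategy k S hε).predict S b u t
    have hwid := hP.width_le 0 (Nat.zero_le _)
    have h1 := ih.abs_dotProduct_le S.h
    have h2 := abs_lt.mp (hv t)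
    have hy : y t - S.h ⬝ᵥ E.center = S.h ⬝ᵥ (x t - E.center) + v t := by
      rw [cl.y_eq, dotProduct_sub]; ring
    -- Half width at most `M 0` plus noise below `V / 2`: the measurement lies in the fundamental
    -- interval of the quantizer, and reduction modulo `L` loses nothing.
    have hlt : |y t - S.h ⬝ᵥ E.center| < D.L / 2 := by
      rw [hy]
      refine (abs_add_le _ _).trans_lt ?_
      have := hD.range_le
      have := hv t
      change width E.shape S.h ≤ M 0 at hwid
      linarith
    obtain ⟨h3, h4⟩ := D.mem_cell (k := k) S hD.L_pos E hlt
    have hyx := cl.y_eq t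
    exact ih.measUpdate hD.dim_pos hP.toPosForm hD.h_ne (by linarith) (by linarith)

theorem IsClosedLoop.mem_carrier
    (cl : IsClosedLoop S (D.strategy k S hε) code ch x₀ w v ξ x u y b) (hD : D.Valid k S M)
    (hx₀ : x₀ ∈ (Ellipsoid.mk S.P₀ 0).carrier) (hw : ∀ t, ‖w t‖ < S.W / 2)
    (hv : ∀ t, |v t| < S.V / 2) (t : ℕ) (hdec : ∀ τ ≤ t, code.decoded ch b ξ t τ = b τ) :
    x (t + 1) ∈ ((D.strategy k S hε).estimate S code ch b u ξ t).carrier := by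
  rw [Strategy.estimate, Strategy.predict_congr _ S u fun s hs => hdec s (by omega)]
  rw [Ellipsoid.mem_carrier_iff (hD.predict b u (t + 1)).toPosForm]
  exact cl.predict_encloses hD hx₀ hw hv (t + 1)

/-- Whatever messages the filter is run on, its error satisfies the recursion `e ↦ F e` up to
bounded terms. -/
theorem Design.Valid.exists_error_bound (hD : D.Valid k S M) (hobs : Observable S.F S.h) :
    ∃ K : ℝ, 0 ≤ K ∧ ∀ E : Ellipsoid m, BoundedShape S.F S.h M E.shape →
      (∀ x, E.Encloses x → ‖x - E.center‖ ≤ K) ∧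
      ∀ (b : Word k) (u : Fin mu → ℝ) (x w : Fin m → ℝ), ‖w‖ ≤ S.W / 2 →
        ‖S.F *ᵥ x + S.G *ᵥ u + w - (D.step S E b u).center - S.F *ᵥ (x - E.center)‖ ≤ K := by
  obtain ⟨K, hK0, hK⟩ := BoundedShape.exists_width_le hobs M
  obtain ⟨C, hC0, hC⟩ := exists_norm_mulVec_le S.F
  refine ⟨K + (C * K + |S.W / 2|), by positivity, fun E hE => ⟨fun x hx => ?_,
    fun b u x w hw => ?_⟩⟩
  · refine (norm_le_of_abs_single_le hK0 fun i => ?_).trans (le_add_of_nonneg_right (by positivity))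
    exact (hx.abs_dotProduct_le _).trans (hK _ hE i)
  · set lo := (D.cell S E b).1 - S.V / 2
    set hi := (D.cell S E b).2 + S.V / 2
    have hle : lo ≤ hi := by
      have h1 : hi - lo = _ := D.cell_sub S E b
      have h2 : 0 ≤ D.L / 2 ^ k := div_nonneg hD.L_pos.le (by positivity)
      have h3 := hD.V_pos
      linarith
    set c := ((E.slab S.h lo hi).1 / √(quad E.shape S.h)) • (E.shape *ᵥ S.h) with hc
    have hq := Real.sqrt_pos.mpr (hE.pos _ hD.h_ne)
    -- The measurement moves the centre by `c`, a point of the centred ellipsoid since `|ξ| ≤ 1`,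
    -- however wrong the slab may be.
    have hcK : ‖c‖ ≤ K := by
      refine norm_le_of_abs_single_le hK0 fun i => ?_
      have h1 := hE.nonnegForm.abs_dotProduct_le (Pi.single i 1) S.h
      have h2 := (E.slab_bounds hD.dim_pos S.h hle).abs_le
      rw [hc, dotProduct_smul, smul_eq_mul, abs_mul, abs_div, abs_of_pos hq, div_mul_eq_mul_div,
        div_le_iff₀ hq]
      calc _ ≤ 1 * (width E.shape (Pi.single i 1) * width E.shape S.h) := by gcongr
        _ ≤ K * √(quad E.shape S.h) := by
          rw [one_mul]
          exact mul_le_mul_of_nonneg_right (hK _ hE i) (width_nonneg _)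
    have heq : S.F *ᵥ x + S.G *ᵥ u + w - (D.step S E b u).center - S.F *ᵥ (x - E.center) =
        w - S.F *ᵥ c := by
      rw [Design.step, Ellipsoid.timeUpdate, Ellipsoid.measUpdate_center]
      simp only [mulVec_add, mulVec_sub]
      abel
    rw [heq]
    have h1 : ‖S.F *ᵥ c‖ ≤ C * K := (hC c).trans (by gcongr)
    have h2 := hw.trans (le_abs_self (S.W / 2))
    have := norm_sub_le w (S.F *ᵥ c)
    linarith

/-- The error of the filter, in terms of the time elapsed since the first wrong message. -/
theorem Design.Valid.exists_tracking_bound (hD : D.Valid k S M) (hobs : Observable S.F S.h)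
    {C₀ ρ : ℝ} (hC₀ : 0 ≤ C₀) (hρ : 1 < ρ) (hF : ∀ (j : ℕ) z, ‖S.F ^ j *ᵥ z‖ ≤ C₀ * ρ ^ j * ‖z‖) :
    ∃ C : ℝ, 0 ≤ C ∧ ∀ (Z Ξ : Type*) [MeasurableSpace Z] [MeasurableSpace Ξ]
      (code : Code n k Z) (ch : Channel n Z Ξ) (x₀ : Fin m → ℝ) (w : ℕ → Fin m → ℝ) (v : ℕ → ℝ)
      (ξ : Ξ) (x : ℕ → Fin m → ℝ) (u : ℕ → Fin mu → ℝ) (y : ℕ → ℝ) (b : ℕ → Word k),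
      IsClosedLoop S (D.strategy k S hε) code ch x₀ w v ξ x u y b →
      x₀ ∈ (Ellipsoid.mk S.P₀ 0).carrier → (∀ t, ‖w t‖ < S.W / 2) → (∀ t, |v t| < S.V / 2) →
      ‖x₀‖ ≤ C ∧ ∀ t,
      ((∀ τ ≤ t, code.decoded ch b ξ t τ = b τ) →
        ‖x (t + 1) - ((D.strategy k S hε).estimate S code ch b u ξ t).center‖ ≤ C) ∧
      ∀ d, ξ ∈ code.firstError ch b t d →
        ‖x (t + 1) - ((D.strategy k S hε).estimate S code ch b u ξ t).center‖ ≤ C * ρ ^ d := by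
  obtain ⟨K, hK0, hK⟩ := hD.exists_error_bound hobs
  have hρ1 : 0 < ρ - 1 := by linarith
  refine ⟨K + C₀ * (K + K / (ρ - 1)), by positivity,
    fun Z Ξ _ _ code ch x₀ w v ξ x u y b cl hx₀ hw hv => ?_⟩
  have hx := cl.predict_encloses hD hx₀ hw hv
  have hle : K ≤ K + C₀ * (K + K / (ρ - 1)) := le_add_of_nonneg_right (by positivity)
  refine ⟨?_, fun t => ⟨fun hdec => ?_, fun d hd => ?_⟩⟩
  · have h0 := (hK _ (hD.predict (hε := hε) b u 0)).1 _ (hx 0)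
    rw [cl.x_zero] at h0
    refine le_trans ?_ (h0.trans hle)
    simp [Strategy.predict]
  · rw [Strategy.estimate, Strategy.predict_congr _ S u fun s hs => hdec s (by omega)]
    exact ((hK _ (hD.predict b u (t + 1))).1 _ (hx (t + 1))).trans hle
  · obtain ⟨τ, hτ, hτd, -, hdec⟩ := hd
    set b' := code.decoded ch b ξ t with hb'
    set e : ℕ → Fin m → ℝ := fun s => x s - ((D.strategy k S hε).predict S b' u s).center with he
    have hrec : ∀ s, e (s + 1) = S.F *ᵥ e s + (e (s + 1) - S.F *ᵥ e s) := fun s => by abel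
    have hf : ∀ s, ‖e (s + 1) - S.F *ᵥ e s‖ ≤ K := fun s => by
      simp only [he]
      rw [cl.x_succ, Design.predict_succ]
      exact (hK _ (hD.predict b' u s)).2 _ _ _ _ (hw s).le
    -- Before `τ` all words used are correct, so at time `τ` the filter still encloses the state;
    -- from then on only the recursion is available.
    have heτ : ‖e τ‖ ≤ K := by
      simp only [he]
      rw [Strategy.predict_congr _ S u hdec]
      exact (hK _ (hD.predict b u τ)).1 _ (hx τ)
    have h1 := norm_linear_recursion_le hC₀ hρ hF hrec hf τ d
    rw [hτd] at h1
    refine h1.trans ?_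
    have h2 : C₀ * (‖e τ‖ + K / (ρ - 1)) ≤ K + C₀ * (K + K / (ρ - 1)) := by
      have : C₀ * (‖e τ‖ + K / (ρ - 1)) ≤ C₀ * (K + K / (ρ - 1)) := by gcongr
      linarith
    gcongr

/-! ### Deadbeat control and the size of the state. -/

theorem IsClosedLoop.exists_input_eq
    (cl : IsClosedLoop S (D.strategy k S hε) code ch x₀ w v ξ x u y b) (hL : 0 < D.L) (t : ℕ) :
    ∃ c : ℝ, |c| ≤ D.L ∧ u t = D.nominal S t
      (stateEstimate (D.strategy k S hε) S code ch b u ξ (m * (t / m))) - c • D.q := by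
  cases t with
  | zero =>
    refine ⟨0, by simp [hL.le], ?_⟩
    rw [cl.u_zero, Nat.zero_div, mul_zero]
    ext a
    simp only [Design.nominal, stateEstimate, Pi.zero_apply, if_true, mulVec_zero, neg_zero,
      zero_smul, sub_zero]
    split_ifs <;> rfl
  | succ t =>
    refine ⟨_, ?_, cl.input_succ t⟩
    rw [abs_mul, abs_of_pos hL, Int.abs_fract]
    exact mul_le_of_le_one_right hL.le (Int.fract_lt_one _).le

/-- Over one block the nominal inputs cancel the free evolution of the estimate, leaving only `F^m`
applied to the estimation error. -/
theorem Design.nominal_deadbeat (hD : D.Valid k S M) (l : ℕ) (xhat : Fin m → ℝ) :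
    ∑ i ∈ Finset.range m, S.F ^ (m - 1 - i) *ᵥ (S.G *ᵥ D.nominal S (m * l + i) xhat) =
      -(S.F ^ m *ᵥ xhat) := by
  have h1 : S.F ^ m *ᵥ xhat = ctrlMatrix S.F S.G *ᵥ (D.R *ᵥ (S.F ^ m *ᵥ xhat)) := by
    rw [mulVec_mulVec _ _ D.R, hD.right_inverse, one_mulVec]
  conv_rhs => rw [h1]
  rw [← mulVec_neg, ctrlMatrix_mulVec, Finset.sum_range]
  refine Fintype.sum_equiv Fin.revPerm _ _ fun i => ?_
  have hmod : (m * l + (i : ℕ)) % m = i := by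
    rw [Nat.mul_add_mod, Nat.mod_eq_of_lt i.2]
  have hlt : (m * l + (i : ℕ)) % m < m := by rw [hmod]; exact i.2
  have hfin : (⟨(m * l + (i : ℕ)) % m, hlt⟩ : Fin m) = i := Fin.ext hmod
  rw [Fin.revPerm_apply, Fin.val_rev, show m - 1 - (i : ℕ) = m - (i + 1) by omega]
  congr 2
  rw [nominal, dif_pos hlt, hfin]
  rfl

theorem Design.exists_nominal_bound (D : Design m mu) (S : Plant m mu) :
    ∃ C : ℝ, 0 ≤ C ∧ ∀ s xhat, ‖D.nominal S s xhat‖ ≤ C * ‖xhat‖ := by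
  obtain ⟨C, hC0, hC⟩ := exists_norm_mulVec_le (D.R * S.F ^ m)
  refine ⟨C, hC0, fun s xhat => ?_⟩
  have h0 : 0 ≤ C * ‖xhat‖ := by positivity
  rw [nominal]
  split_ifs
  · rw [pi_norm_le_iff_of_nonneg h0]
    intro a
    rw [norm_neg, mulVec_mulVec]
    exact (norm_le_pi_norm _ _).trans (hC xhat)
  · rwa [norm_zero]

/-- The state in terms of the errors of the last two estimates at the beginning of a block. -/
theorem Design.Valid.exists_state_bound (hD : D.Valid k S M)
    {C₀ ρ : ℝ} (hC₀ : 0 ≤ C₀) (hρ : 1 < ρ) (hF : ∀ (j : ℕ) z, ‖S.F ^ j *ᵥ z‖ ≤ C₀ * ρ ^ j * ‖z‖) :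
    ∃ C : ℝ, 0 ≤ C ∧ ∀ (Z Ξ : Type*) [MeasurableSpace Z] [MeasurableSpace Ξ]
      (code : Code n k Z) (ch : Channel n Z Ξ) (x₀ : Fin m → ℝ) (w : ℕ → Fin m → ℝ) (v : ℕ → ℝ)
      (ξ : Ξ) (x : ℕ → Fin m → ℝ) (u : ℕ → Fin mu → ℝ) (y : ℕ → ℝ) (b : ℕ → Word k),
      IsClosedLoop S (D.strategy k S hε) code ch x₀ w v ξ x u y b → (∀ t, ‖w t‖ < S.W / 2) →
      ∀ t, ‖x t‖ ≤ C * (1 +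
        ‖x (m * (t / m)) - stateEstimate (D.strategy k S hε) S code ch b u ξ (m * (t / m))‖ +
        ‖x (m * (t / m - 1)) -
          stateEstimate (D.strategy k S hε) S code ch b u ξ (m * (t / m - 1))‖) := by
  obtain ⟨CN, hCN0, hCN⟩ := D.exists_nominal_bound S
  obtain ⟨CG, hCG0, hCG⟩ := exists_norm_mulVec_le S.G
  have hA : ∀ j ≤ m, ∀ z, ‖S.F ^ j *ᵥ z‖ ≤ C₀ * ρ ^ m * ‖z‖ := fun j hj z => by
    refine (hF j z).trans ?_
    have := pow_le_pow_right₀ hρ.le hj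
    gcongr
  set A := C₀ * ρ ^ m
  have hA0 : 0 ≤ A := by positivity
  clear_value A
  set K := D.L * ‖S.G *ᵥ D.q‖ + |S.W / 2|
  have hL := hD.L_pos
  have hK0 : 0 ≤ K := by positivity
  refine ⟨A * ((A + m * A * K + 1) + m * CG * CN * (A + m * A * K + 1 + 1) + m * K),
    by positivity, fun Z Ξ _ _ code ch x₀ w v ξ x u y b cl hw t => ?_⟩
  set xh := stateEstimate (D.strategy k S hε) S code ch b u ξ with hxh
  choose c hc hu using cl.exists_input_eq hD.L_pos
  have hrec : ∀ s, x (s + 1) = S.F *ᵥ x s + (S.G *ᵥ u s + w s) := fun s => by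
    rw [cl.x_succ, add_assoc]
  set g : ℕ → Fin m → ℝ := fun s => w s - c s • (S.G *ᵥ D.q) with hg
  have hgK : ∀ s, ‖g s‖ ≤ K := fun s => by
    have h1 := (hw s).le.trans (le_abs_self (S.W / 2))
    have h2 : ‖c s • (S.G *ᵥ D.q)‖ ≤ D.L * ‖S.G *ᵥ D.q‖ := by
      rw [norm_smul, Real.norm_eq_abs]
      exact mul_le_mul_of_nonneg_right (hc s) (norm_nonneg _)
    have := norm_sub_le (w s) (c s • (S.G *ᵥ D.q))
    simp only [hg, K]
    linarith
  have hf : ∀ l i, i < m → S.G *ᵥ u (m * l + i) + w (m * l + i) =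
      S.G *ᵥ D.nominal S (m * l + i) (xh (m * l)) + g (m * l + i) := fun l i hi => by
    have hdiv : (m * l + i) / m = l := by
      rw [Nat.mul_add_div (by omega), Nat.div_eq_of_lt hi, add_zero]
    conv_lhs => rw [hu, hdiv]
    simp only [hg, mulVec_sub, mulVec_smul]
    abel
  have hblock : ∀ l, ‖x (m * l + m)‖ ≤ A * ‖x (m * l) - xh (m * l)‖ + m * A * K := fun l => by
    rw [linear_recursion hrec, Finset.sum_congr rfl fun i hi => by
      rw [hf l i (Finset.mem_range.mp hi), mulVec_add], Finset.sum_add_distrib,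
      Design.nominal_deadbeat hD, ← add_assoc, ← sub_eq_add_neg, ← mulVec_sub]
    refine (norm_add_le _ _).trans (add_le_add (hA m le_rfl _) ?_)
    calc _ ≤ ∑ _i ∈ Finset.range m, A * K := norm_sum_le_of_le _ fun i _ =>
          (hA _ (by omega) _).trans (mul_le_mul_of_nonneg_left (hgK _) hA0)
      _ = m * A * K := by rw [Finset.sum_const, Finset.card_range, nsmul_eq_mul, mul_assoc]
  -- Within a block the growth is bounded crudely, which suffices since the block length is fixed.
  have hinside : ∀ l i, i ≤ m → ‖x (m * l + i)‖ ≤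
      A * (‖x (m * l)‖ + m * (CG * (CN * ‖xh (m * l)‖) + K)) := fun l i hi => by
    rw [linear_recursion hrec, mul_add]
    refine (norm_add_le _ _).trans (add_le_add (hA i hi _) ?_)
    refine (norm_sum_le_of_le (Finset.range i) (n := fun _ => A * (CG * (CN * ‖xh (m * l)‖) + K))
      fun j hj => ?_).trans ?_
    · have hj' := Finset.mem_range.mp hj
      refine (hA _ (by omega) _).trans (mul_le_mul_of_nonneg_left ?_ hA0)
      rw [hf l j (by omega)]
      refine (norm_add_le _ _).trans (add_le_add ((hCG _).trans ?_) (hgK _))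
      exact mul_le_mul_of_nonneg_left (hCN _ _) hCG0
    · rw [Finset.sum_const, Finset.card_range, nsmul_eq_mul]
      have : (i : ℝ) ≤ m := by exact_mod_cast hi
      have h0 : 0 ≤ A * (CG * (CN * ‖xh (m * l)‖) + K) := by positivity
      calc (i : ℝ) * (A * (CG * (CN * ‖xh (m * l)‖) + K))
          ≤ m * (A * (CG * (CN * ‖xh (m * l)‖) + K)) := by gcongr
        _ = _ := by ring
  set l := t / m with hl
  have ht : t = m * l + t % m := (Nat.div_add_mod t m).symm
  set e₁ := ‖x (m * l) - xh (m * l)‖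
  set e₀ := ‖x (m * (l - 1)) - xh (m * (l - 1))‖ with he₀
  have he₁0 : 0 ≤ e₁ := norm_nonneg _
  have he₀0 : 0 ≤ e₀ := norm_nonneg _
  have hstart : ‖x (m * l)‖ ≤ (A + m * A * K + 1) * (1 + e₀) := by
    rcases Nat.eq_zero_or_pos l with h0 | h0
    · have hxe : ‖x (m * l)‖ = e₀ := by
        rw [he₀, h0, hxh]; simp [stateEstimate]
      rw [hxe]
      have : 0 ≤ (A + m * A * K) * (1 + e₀) := by positivity
      linarith
    · have h1 := hblock (l - 1)
      rw [show m * (l - 1) + m = m * l by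
        obtain ⟨l', hl'⟩ := Nat.exists_eq_succ_of_ne_zero h0.ne'
        rw [hl', Nat.succ_sub_one, Nat.mul_succ]] at h1
      refine h1.trans ?_
      have : 0 ≤ m * A * K * e₀ + A + (1 + e₀) := by positivity
      linarith
  have hxh1 : ‖xh (m * l)‖ ≤ ‖x (m * l)‖ + e₁ := by
    have := norm_sub_le (x (m * l)) (x (m * l) - xh (m * l))
    rwa [sub_sub_cancel] at this
  have h1 := hinside l (t % m) (Nat.mod_lt _ hD.dim_pos).le
  rw [← ht] at h1
  refine h1.trans ?_
  rw [mul_assoc]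
  refine mul_le_mul_of_nonneg_left ?_ hA0
  set B := A + m * A * K + 1
  have hB : 0 ≤ B := by positivity
  have hxh2 : ‖xh (m * l)‖ ≤ (B + 1) * (1 + e₁ + e₀) := by
    have : 0 ≤ B * e₁ + 1 + e₀ := by positivity
    linarith
  have h3 : m * (CG * (CN * ‖xh (m * l)‖)) ≤ m * (CG * (CN * ((B + 1) * (1 + e₁ + e₀)))) := by
    gcongr
  have h4 : 0 ≤ m * K * (e₁ + e₀) + B * e₁ := by positivity
  linarith

end ClosedLoop

/-! ### Spectral radius -/

section SpectralRadius

variable {m : ℕ}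

-- Gelfand's formula gives `‖A^j‖ ≤ ρ^j` for large `j`; the finitely many other powers are absorbed
-- into `C`. Complexification preserves the sup norm of real vectors.
open scoped Matrix.Norms.Operator in
theorem exists_norm_pow_mulVec_le (F : Matrix (Fin m) (Fin m) ℝ) {ρ : ℝ} (hρ0 : 0 < ρ)
    (hρ : specRad F < ρ) :
    ∃ C : ℝ, 0 ≤ C ∧ ∀ (j : ℕ) z, ‖F ^ j *ᵥ z‖ ≤ C * ρ ^ j * ‖z‖ := by
  set A : Matrix (Fin m) (Fin m) ℂ := F.map Complex.ofReal with hA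
  have htop : spectralRadius ℂ A ≠ ⊤ :=
    ((spectrum.spectralRadius_le_pow_nnnorm_pow_one_div ℂ A 0).trans_lt (by
      simp [ENNReal.mul_lt_top])).ne
  have hlt : spectralRadius ℂ A < ENNReal.ofReal ρ :=
    (ENNReal.lt_ofReal_iff_toReal_lt htop).mpr hρ
  have hev := (spectrum.pow_nnnorm_pow_one_div_tendsto_nhds_spectralRadius A).eventually_lt_const hlt
  obtain ⟨N, hN⟩ := eventually_atTop.mp hev
  have hlarge : ∀ j, N + 1 ≤ j → ‖A ^ j‖ ≤ ρ ^ j := fun j hj => by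
    have h1 := hN j (by omega)
    have hj0 : (0 : ℝ) < j := by exact_mod_cast (by omega : 0 < j)
    rw [one_div, ENNReal.rpow_inv_lt_iff hj0, ENNReal.rpow_natCast,
      ← ENNReal.ofReal_pow hρ0.le] at h1
    rw [← ENNReal.ofReal_coe_nnreal, coe_nnnorm] at h1
    exact ((ENNReal.ofReal_lt_ofReal_iff (by positivity)).mp h1).le
  set C := 1 + ∑ j ∈ Finset.range (N + 1), ‖A ^ j‖ / ρ ^ j with hC
  have hsum : 0 ≤ ∑ j ∈ Finset.range (N + 1), ‖A ^ j‖ / ρ ^ j :=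
    Finset.sum_nonneg fun j _ => by positivity
  have hpow : ∀ j, ‖A ^ j‖ ≤ C * ρ ^ j := fun j => by
    rcases lt_or_ge j (N + 1) with hj | hj
    · have h1 := Finset.single_le_sum (f := fun j => ‖A ^ j‖ / ρ ^ j)
        (fun i _ => by positivity) (Finset.mem_range.mpr hj)
      rw [← div_le_iff₀ (by positivity)]
      linarith
    · have h1 := hlarge j hj
      have h2 : 0 ≤ (∑ j ∈ Finset.range (N + 1), ‖A ^ j‖ / ρ ^ j) * ρ ^ j := by positivity
      rw [hC, add_mul]
      linarith
  refine ⟨C, by positivity, fun j z => ?_⟩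
  have hnorm : ∀ z : Fin m → ℝ, ‖fun i => (z i : ℂ)‖ = ‖z‖ := fun z => by
    simp [Pi.norm_def]
  have hmul : (fun i => ((F ^ j *ᵥ z) i : ℂ)) = A ^ j *ᵥ fun i => (z i : ℂ) := by
    have h1 : A ^ j = (F ^ j).map Complex.ofRealHom := (Matrix.map_pow F Complex.ofRealHom j).symm
    ext i
    rw [h1]
    simp [mulVec, dotProduct]
  rw [← hnorm, hmul, ← hnorm z]
  exact (linfty_opNorm_mulVec _ _).trans (by gcongr; exact hpow j)

theorem dim_pos_of_one_lt_specRad {F : Matrix (Fin m) (Fin m) ℝ} (h : 1 < specRad F) : 1 ≤ m := by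
  by_contra! h0
  obtain rfl : m = 0 := by omega
  rw [specRad, spectrum.SpectralRadius.of_subsingleton] at h
  norm_num at h

end SpectralRadius

/-! ### The time elapsed since the first decoding error -/

section Probability

variable {n k m : ℕ} {Z Ξ Ω : Type*} [MeasurableSpace Z] [MeasurableSpace Ξ] [MeasurableSpace Ω]

theorem Code.decoded_congr (code : Code n k Z) (ch : Channel n Z Ξ) {b b' : ℕ → Word k} (ξ : Ξ)
    {t : ℕ} (h : ∀ s ≤ t, b s = b' s) : code.decoded ch b ξ t = code.decoded ch b' ξ t := by
  unfold decoded received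
  congr 1
  ext1 s
  congr 1
  ext1 r
  congr 1
  ext1 q
  exact h q (by omega)

theorem Code.firstError_congr (code : Code n k Z) (ch : Channel n Z Ξ) {b b' : ℕ → Word k}
    {t : ℕ} (d : ℕ) (h : ∀ s ≤ t, b s = b' s) :
    code.firstError ch b t d = code.firstError ch b' t d := by
  ext ξ
  simp only [firstError, Set.mem_ofPred_eq, code.decoded_congr ch ξ h]
  refine exists_congr fun τ => and_congr_right fun hτ => and_congr_right fun _ => ?_
  rw [h τ hτ]
  refine and_congr_right fun _ => forall_congr' fun s => imp_congr_right fun hs => ?_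
  rw [h s (by omega)]

theorem Code.exists_firstError (code : Code n k Z) (ch : Channel n Z Ξ) (b : ℕ → Word k)
    (ξ : Ξ) (t : ℕ) (h : ¬ ∀ τ ≤ t, code.decoded ch b ξ t τ = b τ) :
    ∃ d < t + 2, ξ ∈ code.firstError ch b t d := by
  classical
  push Not at h
  have hs := Nat.find_spec h
  refine ⟨t + 1 - Nat.find h, by omega, Nat.find h, hs.1, by omega, hs.2, fun s hlt => ?_⟩
  by_contra hc
  exact Nat.find_min h hlt ⟨by omega, hc⟩

/-- A bound on the probability of the error events for messages independent of the noise of the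
channel. -/
theorem Code.measure_firstError_le (code : Code n k Z) (ch : Channel n Z Ξ) {ν : Measure Ξ}
    [IsProbabilityMeasure ν] {μ : Measure Ω} [IsProbabilityMeasure μ] {b : Ω → ℕ → Word k}
    (hb : ∀ t, Measurable fun ω => b ω t) {t d : ℕ} {c : ENNReal}
    (hc : ∀ b : ℕ → Word k, ν (code.firstError ch b t d) ≤ c) :
    (μ.prod ν) {p | p.2 ∈ code.firstError ch (b p.1) t d} ≤ c := by
  set f : Ω → (Fin (t + 1) → Word k) := fun ω s => b ω s with hf
  have hfm : Measurable f := measurable_pi_lambda _ fun s => hb s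
  set ext : (Fin (t + 1) → Word k) → ℕ → Word k :=
    fun β s => if hs : s < t + 1 then β ⟨s, hs⟩ else fun _ => false with hext
  -- By causality only the first `t + 1` words matter. There are finitely many such prefixes, and
  -- for each of them the event is a product set.
  have hsub : {p : Ω × Ξ | p.2 ∈ code.firstError ch (b p.1) t d} ⊆
      ⋃ β ∈ (Finset.univ : Finset (Fin (t + 1) → Word k)),
        (f ⁻¹' {β}) ×ˢ code.firstError ch (ext β) t d := by
    intro p hp
    simp only [Set.mem_iUnion, Finset.mem_univ, exists_true_left, Set.mem_prod,
      Set.mem_preimage, Set.mem_singleton_iff]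
    refine ⟨f p.1, rfl, ?_⟩
    rwa [code.firstError_congr ch (b' := b p.1) d fun s hs => by
      simp only [hext, hf, dif_pos (show s < t + 1 by omega)]]
  calc _ ≤ ∑ β, (μ.prod ν) ((f ⁻¹' {β}) ×ˢ code.firstError ch (ext β) t d) :=
        (measure_mono hsub).trans (measure_biUnion_finset_le _ _)
    _ ≤ ∑ β, μ (f ⁻¹' {β}) * c := by
        refine Finset.sum_le_sum fun β _ => ?_
        rw [Measure.prod_prod]
        gcongr
        exact hc _
    _ = c := by
        rw [← Finset.sum_mul, sum_measure_preimage_singleton _ fun β _ =>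
          hfm (measurableSet_singleton β)]
        simp

/-- Errors that grow exponentially with the time elapsed since the first decoding error are
dominated by functions with bounded second moments. -/
theorem Code.AnytimeReliable.exists_dominating {code : Code n k Z} {ch : Channel n Z Ξ}
    {ν : Measure Ξ} [IsProbabilityMeasure ν] {β : ℝ} (hrel : code.AnytimeReliable ch ν β)
    {ρ : ℝ} (hρ : 1 < ρ) (hβ : ρ ^ 2 < (2 : ℝ) ^ ((n : ℝ) * β)) {C : ℝ}
    {μ : Measure Ω} [IsProbabilityMeasure μ] {b : Ω → ℕ → Word k}
    (hb : ∀ t, Measurable fun ω => b ω t) {g : ℕ → Ω × Ξ → ℝ} (hg0 : ∀ t p, 0 ≤ g t p)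
    (hcorrect : ∀ t p, (∀ τ ≤ t, code.decoded ch (b p.1) p.2 t τ = b p.1 τ) → g t p ≤ C)
    (herror : ∀ t p d, p.2 ∈ code.firstError ch (b p.1) t d → g t p ≤ C * ρ ^ d) :
    ∃ (Φ : ℕ → Ω × Ξ → ENNReal) (B : ENNReal), B < ⊤ ∧ (∀ t, Measurable (Φ t)) ∧
      (∀ t p, ENNReal.ofReal (g t p ^ 2) ≤ Φ t p) ∧ ∀ t, ∫⁻ p, Φ t p ∂(μ.prod ν) ≤ B := by
  obtain ⟨d₀, -, η, hη⟩ := hrel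
  set A : ℕ → ℕ → Set (Ω × Ξ) := fun t d => {p | p.2 ∈ code.firstError ch (b p.1) t d} with hA
  set c : ℕ → ENNReal := fun d => ENNReal.ofReal (C ^ 2 * (ρ ^ 2) ^ d) with hc
  set q := ρ ^ 2 / (2 : ℝ) ^ ((n : ℝ) * β) with hq
  have h2pos : (0 : ℝ) < (2 : ℝ) ^ ((n : ℝ) * β) := by positivity
  have hq1 : q < 1 := by rw [hq, div_lt_one h2pos]; exact hβ
  have hq0 : 0 ≤ q := by positivity
  -- For `d < d₀` reliability says nothing and the probability is bounded by one; for the other `d`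
  -- the terms are geometric with ratio `q`.
  set f₁ : ℕ → ENNReal := fun d => if d < d₀ then c d else 0 with hf₁
  set f₂ : ℕ → ENNReal := fun d => ENNReal.ofReal (C ^ 2 * |η| * q ^ d) with hf₂
  have hterm : ∀ t d, c d * (μ.prod ν) (A t d) ≤ f₁ d + f₂ d := fun t d => by
    rcases lt_or_ge d d₀ with hd | hd
    · refine le_add_of_le_left ?_
      simp only [hf₁, if_pos hd]
      exact mul_le_of_le_one_right (zero_le) prob_le_one
    · refine le_add_of_le_right ?_
      have h1 : (μ.prod ν) (A t d) ≤ ENNReal.ofReal (|η| * (((2 : ℝ) ^ ((n : ℝ) * β)) ^ d)⁻¹) := by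
        refine code.measure_firstError_le ch hb fun b => (hη b t d hd).trans ?_
        rw [Real.rpow_neg two_pos.le, Real.rpow_mul two_pos.le, Real.rpow_natCast]
        exact ENNReal.ofReal_le_ofReal
          (mul_le_mul_of_nonneg_right (le_abs_self η) (by positivity))
      refine (mul_le_mul_right h1 (c d)).trans (le_of_eq ?_)
      simp only [hc, hf₂, hq]
      rw [← ENNReal.ofReal_mul (by positivity), div_pow]
      congr 1
      ring
  -- The error events are replaced by measurable hulls of the same measure, so their own
  -- measurability is not required.
  refine ⟨fun t p => ENNReal.ofReal (C ^ 2) + ∑ d ∈ Finset.range (t + 2),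
    (toMeasurable (μ.prod ν) (A t d)).indicator (fun _ => c d) p,
    ENNReal.ofReal (C ^ 2) + (∑' d, f₁ d + ∑' d, f₂ d), ?_, fun t => ?_, fun t p => ?_, fun t => ?_⟩
  · refine ENNReal.add_lt_top.mpr ⟨ENNReal.ofReal_lt_top, ENNReal.add_lt_top.mpr ⟨?_, ?_⟩⟩
    · rw [tsum_eq_sum (s := Finset.range d₀) fun d hd => by
        simp only [hf₁, if_neg (fun h => hd (Finset.mem_range.mpr h))]]
      refine ENNReal.sum_lt_top.mpr fun d _ => ?_
      simp only [hf₁]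
      split_ifs
      · exact ENNReal.ofReal_lt_top
      · exact ENNReal.zero_lt_top
    · exact ((summable_geometric_of_lt_one hq0 hq1).mul_left _).tsum_ofReal_lt_top
  · exact measurable_const.add (Finset.measurable_fun_sum _ fun d _ =>
      (measurable_const (a := c d)).indicator (measurableSet_toMeasurable _ _))
  · by_cases h : ∀ τ ≤ t, code.decoded ch (b p.1) p.2 t τ = b p.1 τ
    · refine le_add_of_le_left (ENNReal.ofReal_le_ofReal ?_)
      have := hg0 t p
      have := hcorrect t p h
      gcongr
    · obtain ⟨d, hd, hmem⟩ := code.exists_firstError ch _ _ _ h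
      refine le_add_of_le_right ?_
      have h1 : c d ≤ (toMeasurable (μ.prod ν) (A t d)).indicator (fun _ => c d) p := by
        have hmem' : p ∈ toMeasurable (μ.prod ν) (A t d) := subset_toMeasurable _ (A t d) hmem
        rw [Set.indicator_of_mem hmem']
      refine le_trans (le_trans (ENNReal.ofReal_le_ofReal ?_) h1)
        (Finset.single_le_sum (f := fun d =>
          (toMeasurable (μ.prod ν) (A t d)).indicator (fun _ => c d) p) (fun _ _ => zero_le)
          (Finset.mem_range.mpr hd))
      have h2 := hg0 t p
      have h3 := herror t p d hmem
      calc g t p ^ 2 ≤ (C * ρ ^ d) ^ 2 := by gcongr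
        _ = _ := by ring
  · rw [lintegral_add_left measurable_const, lintegral_const, measure_univ, mul_one,
      lintegral_finsetSum _ fun d _ =>
        measurable_const.indicator (measurableSet_toMeasurable _ _)]
    gcongr
    calc _ ≤ ∑ d ∈ Finset.range (t + 2), (f₁ d + f₂ d) := by
          refine Finset.sum_le_sum fun d _ => ?_
          rw [lintegral_indicator_const (measurableSet_toMeasurable _ _), measure_toMeasurable]
          exact hterm t d
      _ ≤ ∑' d, (f₁ d + f₂ d) := ENNReal.sum_le_tsum _
      _ = _ := ENNReal.tsum_add

theorem meanSquareBounded_of_lintegral_le {μ : Measure Ω} {X : ℕ → Ω → Fin m → ℝ} {B : ENNReal}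
    (hB : B < ⊤) (h : ∀ t, ∫⁻ ω, ENNReal.ofReal (X t ω ⬝ᵥ X t ω) ∂μ ≤ B) :
    MeanSquareBounded μ X :=
  (limsup_le_of_le (by isBoundedDefault) (Eventually.of_forall h)).trans_lt hB

theorem ofReal_dotProduct_self_le {z : Fin m → ℝ} {r : ℝ} (h : ‖z‖ ≤ r) :
    ENNReal.ofReal (z ⬝ᵥ z) ≤ m * ENNReal.ofReal (r ^ 2) := by
  rw [← ENNReal.ofReal_natCast, ← ENNReal.ofReal_mul (Nat.cast_nonneg m)]
  exact ENNReal.ofReal_le_ofReal (dotProduct_self_le_of_norm_le h)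

end Probability

/-! ### Feasibility of the strategy and mean square bounds -/

section Main

variable {m mu k n : ℕ}

theorem Plant.measurable_free {Ω : Type*} [MeasurableSpace Ω] (S : Plant m mu)
    {x₀ : Ω → Fin m → ℝ} {w : ℕ → Ω → Fin m → ℝ} (hx₀ : Measurable x₀)
    (hw : ∀ t, Measurable (w t)) (t : ℕ) :
    Measurable fun ω => S.free (x₀ ω) (fun s => w s ω) t := by
  induction t with
  | zero => exact hx₀
  | succ t ih =>
    have : Continuous fun z : Fin m → ℝ => S.F *ᵥ z := by fun_prop
    exact (this.measurable.comp ih).add (hw t)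

theorem Design.measurable_message_free {Ω : Type*} [MeasurableSpace Ω] (D : Design m mu)
    (S : Plant m mu) {x₀ : Ω → Fin m → ℝ} {w : ℕ → Ω → Fin m → ℝ} {v : ℕ → Ω → ℝ}
    (hx₀ : Measurable x₀) (hw : ∀ t, Measurable (w t)) (hv : ∀ t, Measurable (v t)) (t : ℕ) :
    Measurable fun ω =>
      D.message k S (fun s => S.h ⬝ᵥ S.free (x₀ ω) (fun r => w r ω) s + v s ω) t := by
  refine (D.measurable_message S t).comp (measurable_pi_lambda _ fun s => ?_)
  have : Continuous fun z : Fin m → ℝ => S.h ⬝ᵥ z := by fun_prop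
  exact (this.measurable.comp (S.measurable_free hx₀ hw s)).add (hv s)

theorem sum_charCoeff_lt {F : Matrix (Fin m) (Fin m) ℝ} (hn : 0 < n)
    (hR : (k : ℝ) / n > 1 / (n : ℝ) *
      Real.logb 2 (√(m : ℝ) * ∑ i ∈ Finset.Icc 1 m,
        |charCoeff F i| * √((m : ℝ) / ((m : ℝ) - 1)) ^ (i - 1))) :
    √(m : ℝ) * ∑ i ∈ Finset.range m, |charCoeff F (i + 1)| * √(gain m) ^ i < 2 ^ k := by
  have hsum : ∑ i ∈ Finset.range m, |charCoeff F (i + 1)| * √(gain m) ^ i =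
      ∑ i ∈ Finset.Icc 1 m, |charCoeff F i| * √((m : ℝ) / ((m : ℝ) - 1)) ^ (i - 1) := by
    rw [← Finset.Ico_add_one_right_eq_Icc, Finset.sum_Ico_eq_sum_range, Nat.add_sub_cancel]
    refine Finset.sum_congr rfl fun i hi => ?_
    have := Finset.mem_range.mp hi
    rw [add_comm 1 i, Nat.add_sub_cancel]
    -- For `m = 1` the base in the rate condition is `√(1 / 0) = 0`, but it occurs only with
    -- exponent `0`.
    by_cases hm1 : m = 1
    · have : i = 0 := by omega
      rw [this, pow_zero, pow_zero]
    · rw [gain, if_neg hm1]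
  rw [hsum]
  set B := √(m : ℝ) * ∑ i ∈ Finset.Icc 1 m,
    |charCoeff F i| * √((m : ℝ) / ((m : ℝ) - 1)) ^ (i - 1)
  have hn' : (0 : ℝ) < n := by exact_mod_cast hn
  rw [gt_iff_lt, one_div_mul_eq_div, div_lt_div_iff_of_pos_right hn'] at hR
  -- If the bracket is not positive its logarithm carries no information, and the claim is trivial.
  rcases le_or_gt B 0 with hB | hB
  · exact hB.trans_lt (by positivity)
  · rwa [Real.logb_lt_iff_lt_rpow one_lt_two hB, Real.rpow_natCast] at hR

theorem exists_valid_design (hn : 0 < n) (S : Plant m mu) (hobs : Observable S.F S.h)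
    (hctrl : Controllable S.F S.G) (hm : 1 ≤ m) (hW : 0 < S.W) (hV : 0 < S.V)
    (hP₀ : S.P₀.PosDef)
    (hR : (k : ℝ) / n > 1 / (n : ℝ) *
      Real.logb 2 (√(m : ℝ) * ∑ i ∈ Finset.Icc 1 m,
        |charCoeff S.F i| * √((m : ℝ) / ((m : ℝ) - 1)) ^ (i - 1))) :
    ∃ (D : Design m mu) (M : ℕ → ℝ), D.Valid k S M := by
  have hh := hobs.ne_zero hm
  obtain ⟨R, hRinv⟩ := hctrl.exists_right_inverse
  obtain ⟨r, q, hr, hq⟩ := exists_relative_degree hm hobs hctrl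
  obtain ⟨ε, hε, hC⟩ := exists_invariant_widths m (by positivity : (0 : ℝ) < 2 ^ k)
    (Real.sqrt_nonneg (gain m)) hV.le (fun i => abs_nonneg (charCoeff S.F (i + 1)))
    (sum_charCoeff_lt hn hR)
  -- One constant dominates both the noise term and the initial widths, so that `C ≤ M i` also
  -- covers `P₀`.
  set c : ℕ → ℝ := fun i => √(S.noiseGain ε) * width 1 (outVec S.F S.h i) +
    width S.P₀ (outVec S.F S.h i) with hc
  have hc1 : ∀ i, 0 ≤ √(S.noiseGain ε) * width 1 (outVec S.F S.h i) := fun i =>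
    mul_nonneg (Real.sqrt_nonneg _) (width_nonneg _)
  have hc2 : ∀ i, 0 ≤ width S.P₀ (outVec S.F S.h i) := fun i => width_nonneg _
  have hc0 : ∀ i, 0 ≤ c i := fun i => add_nonneg (hc1 i) (hc2 i)
  have hcle : ∀ i < m, c i ≤ ∑ i ∈ Finset.range m, c i := fun i hi =>
    Finset.single_le_sum (fun i _ => hc0 i) (Finset.mem_range.mpr hi)
  obtain ⟨L, M, hL, hMm, hCM, hM, hrange⟩ := hC (∑ i ∈ Finset.range m, c i)
    (Finset.sum_nonneg fun i _ => hc0 i)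
  refine ⟨⟨L, ε, R, q, r⟩, M, hm, hh, hV, hL, hε, hr, hq, hRinv, hrange,
    ⟨posForm_of_posDef hP₀, fun i hi => ?_⟩, fun E lo hi u hE hlohi => ?_⟩
  · rcases hi.eq_or_lt with rfl | hlt
    · rw [outVec_dim, width_zero, hMm]
    · exact (le_add_of_nonneg_left (hc1 i)).trans ((hcle i hlt).trans (hCM i hlt))
  · have h2k : 0 < L / 2 ^ k := by positivity
    simp only at hlohi
    exact hE.update hm hh hW hε (Real.sqrt_nonneg _) (fun _ => le_rfl)
      (fun i hi => (le_add_of_nonneg_right (hc2 i)).trans (hcle i hi)) hMm.ge hM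
      (by linarith) hlohi u

end Main

end AnytimeControl

theorem mainTheorem7 {m mu n k : ℕ} (hn : 0 < n) (S : AnytimeControl.Plant m mu)
    (hobs : AnytimeControl.Observable S.F S.h)
    (hctrl : AnytimeControl.Controllable S.F S.G)
    (hρ : 1 < AnytimeControl.specRad S.F)
    (hW : 0 < S.W) (hV : 0 < S.V) (hP₀ : S.P₀.PosDef)
    (hR : (k : ℝ) / n > 1 / (n : ℝ) *
      Real.logb 2 (√(m : ℝ) * ∑ i ∈ Finset.Icc 1 m,
        |AnytimeControl.charCoeff S.F i| * √((m : ℝ) / ((m : ℝ) - 1)) ^ (i - 1))) :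
    ∃ σ : AnytimeControl.Strategy m mu k,
      ∀ (Z : Type*) [MeasurableSpace Z]
        (Ξ : Type*) [MeasurableSpace Ξ] (ν : Measure Ξ) [IsProbabilityMeasure ν]
        (ch : AnytimeControl.Channel n Z Ξ) (code : AnytimeControl.Code n k Z) (β : ℝ),
        (n : ℝ) * β > 2 * Real.logb 2 (AnytimeControl.specRad S.F) →
        code.AnytimeReliable ch ν β →
        ∀ (Ω : Type*) [MeasurableSpace Ω] (μ : Measure Ω) [IsProbabilityMeasure μ]
          (x₀ : Ω → Fin m → ℝ) (w : ℕ → Ω → Fin m → ℝ) (v : ℕ → Ω → ℝ),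
          Measurable x₀ → (∀ t, Measurable (w t)) → (∀ t, Measurable (v t)) →
          (∀ ω, x₀ ω ∈ (AnytimeControl.Ellipsoid.mk S.P₀ 0).carrier) →
          (∀ t ω, ‖w t ω‖ < S.W / 2) → (∀ t ω, |v t ω| < S.V / 2) →
          ∀ (x : ℕ → Ω × Ξ → Fin m → ℝ) (u : ℕ → Ω × Ξ → Fin mu → ℝ)
            (y : ℕ → Ω × Ξ → ℝ) (b : ℕ → Ω × Ξ → AnytimeControl.Word k),
            (∀ p : Ω × Ξ, AnytimeControl.IsClosedLoop S σ code ch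
              (x₀ p.1) (fun t => w t p.1) (fun t => v t p.1) p.2
              (fun t => x t p) (fun t => u t p) (fun t => y t p) (fun t => b t p)) →
            -- the ellipsoid of the filter contains the state if all messages are decoded correctly
            (∀ (p : Ω × Ξ) (t : ℕ),
              (∀ τ ≤ t, code.decoded ch (fun s => b s p) p.2 t τ = b τ p) →
              x (t + 1) p ∈ (σ.estimate S code ch
                (fun s => b s p) (fun s => u s p) p.2 t).carrier) ∧
            -- the filter tracks the state in the mean squared sense
            AnytimeControl.MeanSquareBounded (μ.prod ν) (fun t p => x (t + 1) p -
              (σ.estimate S code ch (fun s => b s p) (fun s => u s p) p.2 t).center) ∧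
            -- the plant is stabilized in the mean squared sense
            AnytimeControl.MeanSquareBounded (μ.prod ν) x := by
  have hm := AnytimeControl.dim_pos_of_one_lt_specRad hρ
  obtain ⟨D, M, hD⟩ := AnytimeControl.exists_valid_design (k := k) hn S hobs hctrl hm hW hV hP₀ hR
  refine ⟨D.strategy k S hD.ε_pos, ?_⟩
  intro Z _ Ξ _ ν _ ch code β hβ hrel Ω _ μ _ x₀ w v hx₀m hwm hvm hx₀ hw hv x u y b cl
  refine ⟨fun p t hdec => (cl p).mem_carrier hD (hx₀ p.1) (fun t => hw t p.1)
    (fun t => hv t p.1) t hdec, ?_⟩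
  have hβ' : AnytimeControl.specRad S.F < √((2 : ℝ) ^ ((n : ℝ) * β)) := by
    have h0 : 0 < AnytimeControl.specRad S.F := by linarith
    apply Real.lt_sqrt_of_sq_lt
    have h1 : 2 * Real.logb 2 (AnytimeControl.specRad S.F) =
        Real.logb 2 (AnytimeControl.specRad S.F ^ 2) := by
      rw [Real.logb_pow, Nat.cast_ofNat]
    rwa [gt_iff_lt, h1, Real.logb_lt_iff_lt_rpow one_lt_two (by positivity)] at hβ
  -- `ρ` exceeds the spectral radius, to bound the powers of `F`, while `ρ² < 2^(nβ)` makes the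
  -- moment series converge.
  obtain ⟨ρ, hρ1, hρ2⟩ := exists_between hβ'
  have hρgt : 1 < ρ := hρ.trans hρ1
  obtain ⟨C₀, hC₀, hF⟩ := AnytimeControl.exists_norm_pow_mulVec_le S.F (by linarith) hρ1
  obtain ⟨C, hC, htrack⟩ := hD.exists_tracking_bound (n := n) (hε := hD.ε_pos) hobs hC₀ hρgt hF
  obtain ⟨C', hC', hstate⟩ := hD.exists_state_bound (n := n) (hε := hD.ε_pos) hC₀ hρgt hF
  set σ := D.strategy k S hD.ε_pos with hσ
  -- The messages as functions of `ω` alone; this independence of the channel noise permits the use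
  -- of reliability, which is stated for fixed messages.
  set bf : Ω → ℕ → AnytimeControl.Word k := fun ω => D.message k S
    (fun s => S.h ⬝ᵥ S.free (x₀ ω) (fun r => w r ω) s + v s ω) with hbf
  have hb : ∀ p : Ω × Ξ, (fun s => b s p) = bf p.1 := fun p => (cl p).message_eq_free hD
  have ht := fun p : Ω × Ξ => htrack Z Ξ code ch _ _ _ _ _ _ _ _ (cl p) (hx₀ p.1)
    (fun t => hw t p.1) (fun t => hv t p.1)
  obtain ⟨Φ, B, hB, hΦm, hΦ, hΦB⟩ := hrel.exists_dominating (μ := μ) (b := bf) (C := C) hρgt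
    ((Real.lt_sqrt (by linarith)).mp hρ2) (D.measurable_message_free S hx₀m hwm hvm)
    (g := fun t p => ‖x (t + 1) p -
      (σ.estimate S code ch (fun s => b s p) (fun s => u s p) p.2 t).center‖)
    (fun _ _ => norm_nonneg _)
    (fun t p hdec => by
      rw [← hb p] at hdec
      exact ((ht p).2 t).1 hdec)
    (fun t p d hd => by
      rw [← hb p] at hd
      exact ((ht p).2 t).2 d hd)
  constructor
  · refine AnytimeControl.meanSquareBounded_of_lintegral_le
      (B := m * B) (ENNReal.mul_lt_top (ENNReal.natCast_lt_top m) hB) fun t => ?_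
    calc _ ≤ ∫⁻ p, m * Φ t p ∂(μ.prod ν) := lintegral_mono fun p =>
          (AnytimeControl.ofReal_dotProduct_self_le le_rfl).trans
            (mul_le_mul_right (hΦ t p) _)
      _ = m * ∫⁻ p, Φ t p ∂(μ.prod ν) := lintegral_const_mul _ (hΦm t)
      _ ≤ m * B := mul_le_mul_right (hΦB t) _
  · set e : ℕ → Ω × Ξ → ℝ := fun s p => ‖x s p - AnytimeControl.stateEstimate σ S code ch
      (fun s => b s p) (fun s => u s p) p.2 s‖ with he
    -- The constant takes care of `s = 0`, where the error is the initial state. Measurable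
    -- majorants are used because `x` is not assumed measurable.
    set Ψ : ℕ → Ω × Ξ → ENNReal := fun s p => ENNReal.ofReal (C ^ 2) + Φ (s - 1) p with hΨ
    have hΨm : ∀ s, Measurable (Ψ s) := fun s => measurable_const.add (hΦm _)
    have heΨ : ∀ s p, ENNReal.ofReal (e s p ^ 2) ≤ Ψ s p := fun s p => by
      cases s with
      | zero =>
        refine le_add_of_le_left (ENNReal.ofReal_le_ofReal ?_)
        have h1 := (ht p).1
        have h2 : e 0 p = ‖x₀ p.1‖ := by
          have := (cl p).x_zero
          simp only [he, AnytimeControl.stateEstimate, if_true, sub_zero]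
          rw [this]
        rw [h2]
        gcongr
      | succ s => exact le_add_of_le_right (hΦ s p)
    have hΨB : ∀ s, ∫⁻ p, Ψ s p ∂(μ.prod ν) ≤ ENNReal.ofReal (C ^ 2) + B := fun s => by
      simp only [hΨ]
      rw [lintegral_add_left measurable_const, lintegral_const, measure_univ, mul_one]
      gcongr
      exact hΦB _
    set B' := ENNReal.ofReal (C ^ 2) + B with hB'
    have hB'top : B' < ⊤ := ENNReal.add_lt_top.mpr ⟨ENNReal.ofReal_lt_top, hB⟩
    refine AnytimeControl.meanSquareBounded_of_lintegral_le
      (B := m * (ENNReal.ofReal (3 * C' ^ 2) * (1 + B' + B')))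
      (ENNReal.mul_lt_top (ENNReal.natCast_lt_top m) (ENNReal.mul_lt_top ENNReal.ofReal_lt_top
        (by simp [hB'top]))) fun t => ?_
    set i := m * (t / m)
    set j := m * (t / m - 1)
    have hpt : ∀ p, ENNReal.ofReal (x t p ⬝ᵥ x t p) ≤
        m * (ENNReal.ofReal (3 * C' ^ 2) * (1 + Ψ i p + Ψ j p)) := fun p => by
      have h1 : ‖x t p‖ ≤ C' * (1 + e i p + e j p) :=
        hstate Z Ξ code ch _ _ _ _ _ _ _ _ (cl p) (fun t => hw t p.1) t
      refine (AnytimeControl.ofReal_dotProduct_self_le h1).trans (mul_le_mul_right ?_ _)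
      have h2 : (C' * (1 + e i p + e j p)) ^ 2 ≤ 3 * C' ^ 2 * (1 + e i p ^ 2 + e j p ^ 2) := by
        have : (1 + e i p + e j p) ^ 2 ≤ 3 * (1 + e i p ^ 2 + e j p ^ 2) := by
          nlinarith [sq_nonneg (1 - e i p), sq_nonneg (1 - e j p), sq_nonneg (e i p - e j p)]
        calc _ = C' ^ 2 * (1 + e i p + e j p) ^ 2 := by ring
          _ ≤ C' ^ 2 * (3 * (1 + e i p ^ 2 + e j p ^ 2)) := by gcongr
          _ = _ := by ring
      refine (ENNReal.ofReal_le_ofReal h2).trans ?_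
      rw [ENNReal.ofReal_mul (by positivity), ENNReal.ofReal_add (by positivity) (by positivity),
        ENNReal.ofReal_add (by positivity) (by positivity), ENNReal.ofReal_one]
      gcongr
      · exact heΨ i p
      · exact heΨ j p
    calc _ ≤ ∫⁻ p, m * (ENNReal.ofReal (3 * C' ^ 2) * (1 + Ψ i p + Ψ j p)) ∂(μ.prod ν) :=
          lintegral_mono hpt
      _ = m * (ENNReal.ofReal (3 * C' ^ 2) *
          (1 + ∫⁻ p, Ψ i p ∂(μ.prod ν) + ∫⁻ p, Ψ j p ∂(μ.prod ν))) := by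
        have hm1 : Measurable fun p => 1 + Ψ i p := measurable_const.add (hΨm i)
        have hm2 : Measurable fun p => 1 + Ψ i p + Ψ j p := hm1.add (hΨm j)
        rw [lintegral_const_mul _ (hm2.const_mul _), lintegral_const_mul _ hm2,
          lintegral_add_left hm1, lintegral_add_left measurable_const, lintegral_const,
          measure_univ, mul_one]
      _ ≤ _ := by
        gcongr
        · exact hΨB i
        · exact hΨB j
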